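/- Let $d\ge 2$. A special Lipschitz domain with constant $M$ is a set which, in some Cartesian coordinate system $(x,t)\in\mathbb R^{d-1}\times\mathbb R$, has the form $\{t>\varphi(x)\}$ with $\varphi:\mathbb R^{d-1}\to\mathbb R$ Lipschitz and $\|\nabla\varphi\|_{L^\infty}\le M$. A nonempty open set $\Omega\subset\mathbb R^d$ (bounded or unbounded, not necessarily connected) is called a Lipschitz domain if there are $\varepsilon>0$, $N\in\mathbb N$, $M>0$ and a countable family $\{U_j\}_j$ of open sets such that (i) for each $x\in\partial\Omega$ the ball $B_\varepsilon(x)$ is contained in some $U_j$; (ii) no point of $\mathbb R^d$ lies in more than $N$ of the $U_j$; (iii) for each $j$ there is a special Lipschitz domain $\Omega_j$ with constant $M$ such that $U_j\cap\Omega=U_j\cap\Omega_j$. For open $\Omega$, let $H^1(\Omega)$ be the Sobolev space of complex-valued $f\in L^2(\Omega)$ with weak gradient $\nabla f\in L^2(\Omega;\mathbb C^d)$, normed by $\|f\|_1^2=\|\nabla f\|_{L^2(\Omega;\mathbb C^d)}^2+\|f\|_{L^2(\Omega)}^2$. An extension operator is a bounded linear operator $E:H^1(\Omega)\to H^1(\mathbb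 R^d)$ with $(Ef)|_\Omega=f$ for all $f$; let $\mathcal E(\Omega):=\inf_E\|E\|$, the infimum of the operator norms over all extension operators ($+\infty$ if there are none). Let $f\mapsto f|_{\partial\Omega}$ denote the trace operator, i.e. the bounded operator $H^1(\Omega)\to L^2(\partial\Omega)$ (with respect to surface measure) that extends the restriction of functions in $C_c^\infty(\mathbb R^d)$. For $\beta\ge 0$ let the Robin Laplacian $-\Delta^\Omega_\beta$ be the self-adjoint operator in $L^2(\Omega)$ associated with the closed, lower-semibounded form $$\mathfrak t^\Omega_\beta[f,g]=(\nabla f,\nabla g)_{L^2(\Omega;\mathbb C^d)}-\beta\,(f|_{\partial\Omega},g|_{\partial\Omega})_{L^2(\partial\Omega)},\qquad \operatorname{dom}\mathfrak t^\Omega_\beta=H^1(\Omega),$$ and let $F_\Omega(\beta):=\inf\sigma(-\Delta_\beta^\Omega)$. **Theorem.** Let $\Omega\subsetneq\mathbb R^d$ be a Lipschitz domain. Then each of the equations $F_\Omega(\beta)=-1$ and $F_{\mathbb R^d\setminus\overline\Omega}(\beta)=-1$ has exactly one solution $\beta>0$; denote these solutions by $\beta(\Omega)$ and $\beta(\mathbb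 R^d\setminus\overline\Omega)$. Moreover $$\mathcal E(\Omega)\ \ge\ \sqrt{1+\frac{\beta(\mathbb R^d\setminus\overline\Omega)}{\beta(\Omega)}} ,$$ and in particular $\max\{\mathcal E(\Omega),\mathcal E(\mathbb R^d\setminus\overline\Omega)\}\ge\sqrt2$. -/

import Mathlib

open MeasureTheory
open scoped ContDiff ENNReal NNReal

noncomputable section

namespace RobinExtension

/-- Euclidean space `ℝ^d`. -/
abbrev Euc (d : ℕ) : Type := EuclideanSpace ℝ (Fin d)

/-! ### Lipschitz domains -/

/-- `D` is a special Lipschitz domain with Lipschitz constant `M`: in a suitable orthonormal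
coordinate system `(x, t) ∈ ℝ^{d-1} × ℝ` it is the set `t > φ x`, where `φ` is `M`-Lipschitz
(equivalently, `φ` is Lipschitz with `‖∇φ‖_∞ ≤ M`).  Translations of the coordinate system are
absorbed by `φ`, so linear isometries suffice. -/
def IsSpecialLipschitz {d : ℕ} (M : ℝ≥0) (D : Set (Euc d)) : Prop :=
  ∃ (e : Euc d ≃ₗᵢ[ℝ] WithLp 2 (Euc (d - 1) × ℝ)) (φ : Euc (d - 1) → ℝ),
    LipschitzWith M φ ∧ D = {y | φ (e y).fst < (e y).snd}

/-- Bounded or unbounded (uniformly) Lipschitz domains, also called minimally smooth domains.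
Connectedness is not imposed, so that the class is stable under passing to the exterior
`ℝ^d ∖ closure Ω`.  A countable family is indexed by `ℕ`; members may be empty. -/
structure IsLipschitzDomain {d : ℕ} (Ω : Set (Euc d)) : Prop where
  isOpen : IsOpen Ω
  nonempty : Ω.Nonempty
  exists_cover : ∃ (ε : ℝ) (N : ℕ) (M : ℝ≥0) (U : ℕ → Set (Euc d)),
    0 < ε ∧ (∀ j, IsOpen (U j)) ∧
    (∀ x ∈ frontier Ω, ∃ j, Metric.ball x ε ⊆ U j) ∧
    (∀ x, {j | x ∈ U j}.encard ≤ N) ∧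
    (∀ j, ∃ D, IsSpecialLipschitz M D ∧ U j ∩ Ω = U j ∩ D)

/-! ### The Sobolev space `H¹(Ω)` -/

/-- `L²(Ω)`, complex valued. -/
abbrev L2 {d : ℕ} (Ω : Set (Euc d)) : Type := Lp ℂ 2 (volume.restrict Ω)

/-- `L²(Ω; ℂ^d)`. -/
abbrev L2Vec {d : ℕ} (Ω : Set (Euc d)) : Type :=
  Lp (EuclideanSpace ℂ (Fin d)) 2 (volume.restrict Ω)

/-- `φ ∈ C_c^∞(Ω)`. -/
structure IsTestFunction {d : ℕ} (Ω : Set (Euc d)) (φ : Euc d → ℂ) : Prop where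
  smooth : ContDiff ℝ ∞ φ
  compact : HasCompactSupport φ
  subset : tsupport φ ⊆ Ω

/-- The partial derivative `∂φ/∂x_i`. -/
def partialDeriv {d : ℕ} (i : Fin d) (φ : Euc d → ℂ) (x : Euc d) : ℂ :=
  fderiv ℝ φ x (EuclideanSpace.single i 1)

/-- `G` is the weak (distributional) gradient of `f` in `Ω`. -/
def IsWeakGradient {d : ℕ} (Ω : Set (Euc d)) (f : L2 Ω) (G : L2Vec Ω) : Prop :=
  ∀ φ : Euc d → ℂ, IsTestFunction Ω φ → ∀ i : Fin d,
    ∫ x in Ω, f x * partialDeriv i φ x = - ∫ x in Ω, G x i * φ x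

theorem IsTestFunction.memLp {d : ℕ} {Ω : Set (Euc d)} {φ : Euc d → ℂ}
    (hφ : IsTestFunction Ω φ) : MemLp φ 2 (volume.restrict Ω) :=
  (hφ.smooth.continuous.memLp_of_hasCompactSupport hφ.compact).restrict Ω

theorem IsTestFunction.partialDeriv_memLp {d : ℕ} {Ω : Set (Euc d)} {φ : Euc d → ℂ}
    (hφ : IsTestFunction Ω φ) (i : Fin d) :
    MemLp (partialDeriv i φ) 2 (volume.restrict Ω) := by
  have hc : Continuous (partialDeriv i φ) :=
    (hφ.smooth.continuous_fderiv (by simp)).clm_apply continuous_const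
  exact (hc.memLp_of_hasCompactSupport (hφ.compact.fderiv_apply ℝ _)).restrict Ω

theorem coord_memLp {d : ℕ} {Ω : Set (Euc d)} (G : L2Vec Ω) (i : Fin d) :
    MemLp (fun x => G x i) 2 (volume.restrict Ω) :=
  (EuclideanSpace.proj i : EuclideanSpace ℂ (Fin d) →L[ℂ] ℂ).comp_memLp' (Lp.memLp G)

theorem IsTestFunction.integrable_left {d : ℕ} {Ω : Set (Euc d)} {φ : Euc d → ℂ}
    (hφ : IsTestFunction Ω φ) (f : L2 Ω) (i : Fin d) :
    Integrable (fun x => f x * partialDeriv i φ x) (volume.restrict Ω) :=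
  (Lp.memLp f).integrable_mul (hφ.partialDeriv_memLp i)

theorem IsTestFunction.integrable_right {d : ℕ} {Ω : Set (Euc d)} {φ : Euc d → ℂ}
    (hφ : IsTestFunction Ω φ) (G : L2Vec Ω) (i : Fin d) :
    Integrable (fun x => G x i * φ x) (volume.restrict Ω) :=
  (coord_memLp G i).integrable_mul hφ.memLp

theorem isWeakGradient_zero {d : ℕ} (Ω : Set (Euc d)) : IsWeakGradient Ω 0 0 := by
  intro φ hφ i
  have h1 : ∫ x in Ω, (0 : L2 Ω) x * partialDeriv i φ x = 0 := by
    rw [← integral_zero (Euc d) ℂ (μ := volume.restrict Ω)]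
    refine integral_congr_ae ?_
    filter_upwards [Lp.coeFn_zero ℂ 2 (volume.restrict Ω)] with x hx
    rw [hx]; simp
  have h2 : ∫ x in Ω, (0 : L2Vec Ω) x i * φ x = 0 := by
    rw [← integral_zero (Euc d) ℂ (μ := volume.restrict Ω)]
    refine integral_congr_ae ?_
    filter_upwards [Lp.coeFn_zero (EuclideanSpace ℂ (Fin d)) 2 (volume.restrict Ω)] with x hx
    rw [hx]; simp
  rw [h1, h2, neg_zero]

theorem IsWeakGradient.add {d : ℕ} {Ω : Set (Euc d)} {f g : L2 Ω} {F G : L2Vec Ω}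
    (hf : IsWeakGradient Ω f F) (hg : IsWeakGradient Ω g G) :
    IsWeakGradient Ω (f + g) (F + G) := by
  intro φ hφ i
  have h1 : ∫ x in Ω, (f + g) x * partialDeriv i φ x =
      (∫ x in Ω, f x * partialDeriv i φ x) + ∫ x in Ω, g x * partialDeriv i φ x := by
    rw [← integral_add (hφ.integrable_left f i) (hφ.integrable_left g i)]
    refine integral_congr_ae ?_
    filter_upwards [Lp.coeFn_add f g] with x hx
    rw [hx, Pi.add_apply, add_mul]
  have h2 : ∫ x in Ω, (F + G) x i * φ x =
      (∫ x in Ω, F x i * φ x) + ∫ x in Ω, G x i * φ x := by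
    rw [← integral_add (hφ.integrable_right F i) (hφ.integrable_right G i)]
    refine integral_congr_ae ?_
    filter_upwards [Lp.coeFn_add F G] with x hx
    rw [hx, Pi.add_apply, PiLp.add_apply, add_mul]
  rw [h1, h2, hf φ hφ i, hg φ hφ i]
  ring

theorem IsWeakGradient.smul {d : ℕ} {Ω : Set (Euc d)} (c : ℂ) {f : L2 Ω} {F : L2Vec Ω}
    (hf : IsWeakGradient Ω f F) : IsWeakGradient Ω (c • f) (c • F) := by
  intro φ hφ i
  have h1 : ∫ x in Ω, (c • f) x * partialDeriv i φ x =
      c * ∫ x in Ω, f x * partialDeriv i φ x := by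
    rw [← integral_const_mul]
    refine integral_congr_ae ?_
    filter_upwards [Lp.coeFn_smul c f] with x hx
    rw [hx, Pi.smul_apply, smul_eq_mul, mul_assoc]
  have h2 : ∫ x in Ω, (c • F) x i * φ x = c * ∫ x in Ω, F x i * φ x := by
    rw [← integral_const_mul]
    refine integral_congr_ae ?_
    filter_upwards [Lp.coeFn_smul c F] with x hx
    rw [hx, Pi.smul_apply, PiLp.smul_apply, smul_eq_mul, mul_assoc]
  rw [h1, h2, hf φ hφ i]
  ring

/-- The Sobolev space `H¹(Ω)`: an element is a function `f ∈ L²(Ω)` together with its (unique)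
weak gradient `∇f ∈ L²(Ω; ℂ^d)`.  The norm inherited from the `ℓ²`-product is
`‖f‖₁² = ‖f‖²_{L²(Ω)} + ‖∇f‖²_{L²(Ω; ℂ^d)}`. -/
def H1 {d : ℕ} (Ω : Set (Euc d)) : Submodule ℂ (WithLp 2 (L2 Ω × L2Vec Ω)) where
  carrier := {p | IsWeakGradient Ω p.fst p.snd}
  add_mem' hp hq := IsWeakGradient.add hp hq
  zero_mem' := isWeakGradient_zero Ω
  smul_mem' c _ hp := IsWeakGradient.smul c hp

/-- The function in `L²(Ω)` underlying an element of `H¹(Ω)`. -/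
def toL2 {d : ℕ} {Ω : Set (Euc d)} : H1 Ω →ₗ[ℂ] L2 Ω where
  toFun u := (u : WithLp 2 (L2 Ω × L2Vec Ω)).fst
  map_add' _ _ := rfl
  map_smul' _ _ := rfl

/-- The weak gradient of an element of `H¹(Ω)`. -/
def grad {d : ℕ} {Ω : Set (Euc d)} : H1 Ω →ₗ[ℂ] L2Vec Ω where
  toFun u := (u : WithLp 2 (L2 Ω × L2Vec Ω)).snd
  map_add' _ _ := rfl
  map_smul' _ _ := rfl

/-! ### Extension operators -/

/-- A bounded linear operator `H¹(Ω) → H¹(ℝ^d)` is an extension operator if `(E f)|_Ω = f`. -/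
def IsExtensionOperator {d : ℕ} {Ω : Set (Euc d)}
    (E : H1 Ω →L[ℂ] H1 (Set.univ : Set (Euc d))) : Prop :=
  ∀ f : H1 Ω, toL2 (E f) =ᵐ[volume.restrict Ω] toL2 f

/-- The infimum of the norms of all extension operators (`∞` if there are none). -/
def extNorm {d : ℕ} (Ω : Set (Euc d)) : ℝ≥0∞ :=
  ⨅ (E : H1 Ω →L[ℂ] H1 (Set.univ : Set (Euc d))) (_ : IsExtensionOperator E), ‖E‖ₑ

/-! ### Boundary traces -/

/-- The surface measure on `∂Ω`: the `(d-1)`-dimensional Hausdorff measure, normalized so as to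
agree with Lebesgue measure on hyperplanes. -/
def surfaceMeasure {d : ℕ} (Ω : Set (Euc d)) : Measure (Euc d) :=
  (Measure.euclideanHausdorffMeasure (d - 1)).restrict (frontier Ω)

/-- `L²(∂Ω)`. -/
abbrev L2Boundary {d : ℕ} (Ω : Set (Euc d)) : Type := Lp ℂ 2 (surfaceMeasure Ω)

/-- `T` is a trace operator: it is bounded from `H¹(Ω)` to `L²(∂Ω)` and maps the restriction to
`Ω` of any `φ ∈ C_c^∞(ℝ^d)` to the restriction of `φ` to `∂Ω`. -/
def IsTraceOperator {d : ℕ} {Ω : Set (Euc d)} (T : H1 Ω →L[ℂ] L2Boundary Ω) : Prop :=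
  ∀ φ : Euc d → ℂ, IsTestFunction Set.univ φ →
    ∀ u : H1 Ω, toL2 u =ᵐ[volume.restrict Ω] φ → T u =ᵐ[surfaceMeasure Ω] φ

open Classical in
/-- The trace operator `f ↦ f|_{∂Ω}`.  For a Lipschitz domain it exists, and it is unique because
the restrictions of functions in `C_c^∞(ℝ^d)` are dense in `H¹(Ω)`. -/
def trace {d : ℕ} (Ω : Set (Euc d)) : H1 Ω →L[ℂ] L2Boundary Ω :=
  if h : ∃ T : H1 Ω →L[ℂ] L2Boundary Ω, IsTraceOperator T then h.choose else 0

/-! ### The Robin Laplacian -/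

/-- The sesquilinear form
`t_β[f, g] = (∇f, ∇g)_{L²(Ω; ℂ^d)} - β (f|_{∂Ω}, g|_{∂Ω})_{L²(∂Ω)}` with domain `H¹(Ω)`,
linear in `f` and conjugate linear in `g`. -/
def robinForm {d : ℕ} (Ω : Set (Euc d)) (β : ℝ) (f g : H1 Ω) : ℂ :=
  inner ℂ (grad g) (grad f) - (β : ℂ) * inner ℂ (trace Ω g) (trace Ω f)

/-- The graph of the operator `A` associated with the form `t_β` by the first representation
theorem: `f ∈ dom A` and `A f = h` iff `f ∈ H¹(Ω)` and `t_β[f, g] = (h, g)` for all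
`g ∈ H¹(Ω)`. -/
def robinGraph {d : ℕ} (Ω : Set (Euc d)) (β : ℝ) : Submodule ℂ (L2 Ω × L2 Ω) where
  carrier := {p | ∃ f : H1 Ω, toL2 f = p.1 ∧
    ∀ g : H1 Ω, robinForm Ω β f g = inner ℂ (toL2 g) p.2}
  zero_mem' := ⟨0, by simp, fun g => by simp [robinForm]⟩
  add_mem' := by
    rintro p q ⟨f, hf, hfg⟩ ⟨f', hf', hfg'⟩
    refine ⟨f + f', by simp [hf, hf'], fun g => ?_⟩
    have h1 := hfg g
    have h2 := hfg' g
    simp only [robinForm] at h1 h2 ⊢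
    rw [Prod.snd_add, inner_add_right, ← h1, ← h2]
    simp only [map_add, inner_add_right]
    ring
  smul_mem' := by
    rintro c p ⟨f, hf, hfg⟩
    refine ⟨c • f, by simp [hf], fun g => ?_⟩
    have h1 := hfg g
    simp only [robinForm] at h1 ⊢
    rw [Prod.smul_snd, inner_smul_right, ← h1]
    simp only [map_smul, inner_smul_right]
    ring

/-- The Robin Laplacian `-Δ_β^Ω`, an unbounded operator in `L²(Ω)`. -/
def robinLaplacian {d : ℕ} (Ω : Set (Euc d)) (β : ℝ) : L2 Ω →ₗ.[ℂ] L2 Ω :=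
  (robinGraph Ω β).toLinearPMap

/-- The resolvent set of an unbounded operator `A`: those `z` for which `A - z` is a bijection
from `dom A` onto the whole space with a bounded inverse `R`. -/
def unboundedResolventSet {H : Type*} [NormedAddCommGroup H] [InnerProductSpace ℂ H]
    (A : H →ₗ.[ℂ] H) : Set ℂ :=
  {z | ∃ R : H →L[ℂ] H,
    (∀ x : A.domain, R (A x - z • (x : H)) = x) ∧
    (∀ y : H, ∃ x : A.domain, (x : H) = R y ∧ A x - z • (x : H) = y)}

/-- The spectrum of an unbounded operator. -/
def unboundedSpectrum {H : Type*} [NormedAddCommGroup H] [InnerProductSpace ℂ H]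
    (A : H →ₗ.[ℂ] H) : Set ℂ :=
  (unboundedResolventSet A)ᶜ

/-- `F_Ω(β) = inf σ(-Δ_β^Ω)`, the bottom of the spectrum of the Robin Laplacian. -/
def robinBottom {d : ℕ} (Ω : Set (Euc d)) (β : ℝ) : ℝ :=
  sInf {t : ℝ | (t : ℂ) ∈ unboundedSpectrum (robinLaplacian Ω β)}

/-- `β` is a positive root of `F_Ω(β) = -1`. -/
def IsRobinRoot {d : ℕ} (Ω : Set (Euc d)) (β : ℝ) : Prop :=
  0 < β ∧ robinBottom Ω β = -1

end RobinExtension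

end

noncomputable section

namespace RobinExtension

open Filter Topology

variable {d : ℕ}

/-! ### Elementary facts about `H¹(Ω)` -/

/-! Both Robin roots are operator norms in disguise. Adding the squared `L²` norm to the Robin form
gives `‖u‖² - β ‖trace Ω u‖²` with the full `H¹` norm, so the bottom of the spectrum is `-1` exactly
when this expression is nonnegative and no positive multiple of `‖toL2 u‖²` bounds it from below.
That forces `β = 1 / ‖trace Ω‖²` (`isRobinRoot_iff`), hence existence and uniqueness, and the
quotient of the exterior root by the interior root is `‖trace Ω‖² / ‖trace (closure Ω)ᶜ‖²`.

An extension `E f` splits into `f` on `Ω` and a remainder on the exterior. The remainder has the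
same boundary values as `f`, so its squared `H¹` norm is at least `‖trace Ω f‖² / ‖trace (closure
Ω)ᶜ‖²` (`IsLipschitzDomain.norm_sq_add_le`). Optimizing over `f` yields the lower bound for `‖E‖`.
Since the exterior of the exterior is `Ω`, the two bounds involve reciprocal quotients; one of these
is at least `1`, which gives `√2`.

The analytic input is threefold. Functions in `C_c^∞(ℝ^d)` are dense in `H¹(Ω)`
(`denseRange_testH1`), by mollification along cones that stay in `Ω`. The boundary norm is
infinitesimally small relative to the gradient (`IsLipschitzDomain.hasTraceBound`), by integration
along vertical segments in the charts; this gives the trace operator and semiboundedness of the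
form. Finally, the bottom of the spectrum is the infimum of the Rayleigh quotient
(`robinBottom_eq`), by Lax–Milgram below the infimum and a direct argument at it. -/

theorem norm_sq_eq {Ω : Set (Euc d)} (u : H1 Ω) :
    ‖u‖ ^ 2 = ‖toL2 u‖ ^ 2 + ‖grad u‖ ^ 2 :=
  WithLp.prod_norm_sq_eq_of_L2 (u : WithLp 2 (L2 Ω × L2Vec Ω))

theorem inner_eq {Ω : Set (Euc d)} (u v : H1 Ω) :
    inner ℂ u v = inner ℂ (toL2 u) (toL2 v) + inner ℂ (grad u) (grad v) :=
  WithLp.prod_inner_apply (u : WithLp 2 (L2 Ω × L2Vec Ω)) v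

theorem norm_toL2_le {Ω : Set (Euc d)} (u : H1 Ω) : ‖toL2 u‖ ≤ ‖u‖ := by
  have := norm_sq_eq u
  exact (abs_le_of_sq_le_sq' (by nlinarith [sq_nonneg ‖grad u‖]) (norm_nonneg _)).2

theorem norm_grad_le {Ω : Set (Euc d)} (u : H1 Ω) : ‖grad u‖ ≤ ‖u‖ := by
  have := norm_sq_eq u
  exact (abs_le_of_sq_le_sq' (by nlinarith [sq_nonneg ‖toL2 u‖]) (norm_nonneg _)).2

/-- The embedding `H¹(Ω) → L²(Ω)` as a bounded operator. -/
def toL2CLM (Ω : Set (Euc d)) : H1 Ω →L[ℂ] L2 Ω :=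
  toL2.mkContinuous 1 fun u => by simpa using norm_toL2_le u

@[simp] theorem toL2CLM_apply {Ω : Set (Euc d)} (u : H1 Ω) : toL2CLM Ω u = toL2 u := rfl

/-- The gradient `H¹(Ω) → L²(Ω; ℂ^d)` as a bounded operator. -/
def gradCLM (Ω : Set (Euc d)) : H1 Ω →L[ℂ] L2Vec Ω :=
  grad.mkContinuous 1 fun u => by simpa using norm_grad_le u

@[simp] theorem gradCLM_apply {Ω : Set (Euc d)} (u : H1 Ω) : gradCLM Ω u = grad u := rfl

theorem isWeakGradient {Ω : Set (Euc d)} (u : H1 Ω) : IsWeakGradient Ω (toL2 u) (grad u) := u.2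

theorem integral_mul_eq_inner {Ω : Set (Euc d)} (f : L2 Ω) {φ : Euc d → ℂ}
    (hφ : MemLp (fun x => starRingEnd ℂ (φ x)) 2 (volume.restrict Ω)) :
    ∫ x in Ω, f x * φ x = inner ℂ (hφ.toLp _) f := by
  rw [L2.inner_def]
  refine integral_congr_ae ?_
  filter_upwards [hφ.coeFn_toLp] with x hx
  rw [hx]
  simp

theorem memLp_conj {μ : Measure (Euc d)} {φ : Euc d → ℂ} (hφ : MemLp φ 2 μ) :
    MemLp (fun x => starRingEnd ℂ (φ x)) 2 μ := hφ.star

/-- The `i`-th coordinate as a bounded operator `L²(Ω; ℂ^d) → L²(Ω)`. -/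
def coordL2 (Ω : Set (Euc d)) (i : Fin d) : L2Vec Ω →L[ℂ] L2 Ω :=
  (EuclideanSpace.proj i : EuclideanSpace ℂ (Fin d) →L[ℂ] ℂ).compLpL 2 _

theorem coordL2_ae {Ω : Set (Euc d)} (i : Fin d) (G : L2Vec Ω) :
    coordL2 Ω i G =ᵐ[volume.restrict Ω] fun x => G x i :=
  (EuclideanSpace.proj i : EuclideanSpace ℂ (Fin d) →L[ℂ] ℂ).coeFn_compLpL G

/-- Each test function and coordinate imposes the equality of two continuous functions of the pair,
so the graph of the weak gradient is closed. The resulting completeness is what permits adjoints,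
orthogonal complements and Lax–Milgram in `H¹(Ω)`. -/
theorem isClosed_H1 (Ω : Set (Euc d)) :
    IsClosed (H1 Ω : Set (WithLp 2 (L2 Ω × L2Vec Ω))) := by
  have : (H1 Ω : Set (WithLp 2 (L2 Ω × L2Vec Ω))) =
      ⋂ (φ : Euc d → ℂ) (hφ : IsTestFunction Ω φ) (i : Fin d),
        {p | inner ℂ ((memLp_conj (hφ.partialDeriv_memLp i)).toLp _) p.fst =
          - inner ℂ ((memLp_conj hφ.memLp).toLp _) (coordL2 Ω i p.snd)} := by
    ext p
    simp only [Set.mem_iInter, Set.mem_ofPred_eq]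
    refine forall_congr' fun φ => forall_congr' fun hφ => forall_congr' fun i => ?_
    rw [← integral_mul_eq_inner, ← integral_mul_eq_inner]
    have : ∫ x in Ω, coordL2 Ω i p.snd x * φ x = ∫ x in Ω, p.snd x i * φ x := by
      refine integral_congr_ae ?_
      filter_upwards [coordL2_ae i p.snd] with x hx
      rw [hx]
    rw [this]
  rw [this]
  refine isClosed_iInter fun φ => isClosed_iInter fun hφ => isClosed_iInter fun i => ?_
  refine isClosed_eq ?_ ?_
  · exact continuous_const.inner (WithLp.fstL 2 ℂ _ _).continuous
  · exact (continuous_const.inner ((coordL2 Ω i).continuous.comp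
      (WithLp.sndL 2 ℂ _ _).continuous)).neg

instance (Ω : Set (Euc d)) : CompleteSpace (H1 Ω) := (isClosed_H1 Ω).completeSpace_coe

theorem IsTestFunction.mono {Ω Ω' : Set (Euc d)} {φ : Euc d → ℂ} (hφ : IsTestFunction Ω φ)
    (h : Ω ⊆ Ω') : IsTestFunction Ω' φ := ⟨hφ.smooth, hφ.compact, hφ.subset.trans h⟩

theorem IsTestFunction.ofReal {Ω : Set (Euc d)} {g : Euc d → ℝ} (hg : ContDiff ℝ ∞ g)
    (hc : HasCompactSupport g) (hs : tsupport g ⊆ Ω) :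
    IsTestFunction Ω (fun x => (g x : ℂ)) := by
  refine ⟨Complex.ofRealCLM.contDiff.comp hg, hc.comp_left (g := Complex.ofReal) Complex.ofReal_zero, ?_⟩
  exact (tsupport_comp_subset Complex.ofReal_zero g).trans hs

theorem ae_eq_zero_of_forall_integral_mul {Ω : Set (Euc d)} (hΩ : IsOpen Ω) {f : Euc d → ℂ}
    (hf : MemLp f 2 (volume.restrict Ω))
    (h : ∀ φ, IsTestFunction Ω φ → ∫ x in Ω, f x * φ x = 0) : f =ᵐ[volume.restrict Ω] 0 := by
  have hloc : LocallyIntegrableOn f Ω volume :=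
    locallyIntegrableOn_of_locallyIntegrable_restrict (hf.locallyIntegrable (by norm_num))
  have := hΩ.ae_eq_zero_of_integral_contDiff_smul_eq_zero hloc (fun g hg hc hs => by
    have h1 := h _ (IsTestFunction.ofReal hg hc hs)
    rw [← h1, ← integral_indicator hΩ.measurableSet]
    congr 1
    ext x
    by_cases hx : x ∈ Ω
    · simp [hx, mul_comm]
    · have : g x = 0 := image_eq_zero_of_notMem_tsupport fun h' => hx (hs h')
      simp [hx, this])
  rw [EventuallyEq, ae_restrict_iff' hΩ.measurableSet]
  exact this

/-- Uniqueness of the weak gradient, from the fundamental lemma of the calculus of variations. It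
allows elements of `H1 Ω` to be identified by their functions alone. -/
theorem toL2_injective {Ω : Set (Euc d)} (hΩ : IsOpen Ω) :
    Function.Injective (toL2 : H1 Ω → L2 Ω) := by
  rw [injective_iff_map_eq_zero]
  intro u hu
  have h2 : grad u = 0 := by
    have key : ∀ i : Fin d, (fun x => grad u x i) =ᵐ[volume.restrict Ω] 0 := fun i => by
      refine ae_eq_zero_of_forall_integral_mul hΩ (coord_memLp _ i) fun φ hφ => ?_
      have := isWeakGradient u φ hφ i
      rw [hu] at this
      have h0 : ∫ x in Ω, (0 : L2 Ω) x * partialDeriv i φ x = 0 := by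
        rw [← integral_zero (Euc d) ℂ (μ := volume.restrict Ω)]
        refine integral_congr_ae ?_
        filter_upwards [Lp.coeFn_zero ℂ 2 (volume.restrict Ω)] with x hx
        rw [hx]; simp
      rw [h0] at this
      exact neg_eq_zero.mp this.symm
    rw [Lp.eq_zero_iff_ae_eq_zero]
    filter_upwards [ae_all_iff.mpr key] with x hx
    ext i
    exact hx i
  have : ‖u‖ ^ 2 = 0 := by rw [norm_sq_eq, hu, h2]; simp
  simpa using this

/-! ### Restrictions of test functions -/

/-- The space `C_c^∞(ℝ^d)`. -/
def testSpace (d : ℕ) : Submodule ℂ (Euc d → ℂ) where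
  carrier := {φ | IsTestFunction Set.univ φ}
  add_mem' hφ hψ := ⟨hφ.smooth.add hψ.smooth, hφ.compact.add hψ.compact, Set.subset_univ _⟩
  zero_mem' := ⟨contDiff_const, HasCompactSupport.zero, Set.subset_univ _⟩
  smul_mem' c _ hφ := ⟨contDiff_const.smul hφ.smooth,
    hφ.compact.smul_left (f := fun _ => c), Set.subset_univ _⟩

/-- The classical gradient. -/
def gradFun (φ : Euc d → ℂ) (x : Euc d) : EuclideanSpace ℂ (Fin d) :=
  WithLp.toLp 2 fun i => partialDeriv i φ x

theorem IsTestFunction.continuous_partialDeriv {Ω : Set (Euc d)} {φ : Euc d → ℂ}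
    (hφ : IsTestFunction Ω φ) (i : Fin d) : Continuous (partialDeriv i φ) :=
  (hφ.smooth.continuous_fderiv (by simp)).clm_apply continuous_const

theorem IsTestFunction.hasCompactSupport_partialDeriv {Ω : Set (Euc d)} {φ : Euc d → ℂ}
    (hφ : IsTestFunction Ω φ) (i : Fin d) : HasCompactSupport (partialDeriv i φ) :=
  hφ.compact.fderiv_apply ℝ _

theorem tsupport_partialDeriv_subset (i : Fin d) (φ : Euc d → ℂ) :
    tsupport (partialDeriv i φ) ⊆ tsupport φ :=
  tsupport_fderiv_apply_subset ℝ _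

theorem IsTestFunction.continuous_gradFun {Ω : Set (Euc d)} {φ : Euc d → ℂ}
    (hφ : IsTestFunction Ω φ) : Continuous (gradFun φ) :=
  (PiLp.continuous_toLp 2 _).comp (continuous_pi fun i => hφ.continuous_partialDeriv i)

theorem gradFun_eq_zero {φ : Euc d → ℂ} {x : Euc d} (hx : x ∉ tsupport φ) : gradFun φ x = 0 := by
  ext i
  exact image_eq_zero_of_notMem_tsupport (f := partialDeriv i φ) fun h => hx (tsupport_partialDeriv_subset i φ h)

theorem IsTestFunction.memLp_gradFun {Ω : Set (Euc d)} {φ : Euc d → ℂ}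
    (hφ : IsTestFunction Ω φ) (μ : Measure (Euc d)) [IsFiniteMeasureOnCompacts μ] :
    MemLp (gradFun φ) 2 μ :=
  hφ.continuous_gradFun.memLp_of_hasCompactSupport
    (HasCompactSupport.intro hφ.compact fun _ hx => gradFun_eq_zero hx)

theorem IsTestFunction.memLp' {Ω : Set (Euc d)} {φ : Euc d → ℂ}
    (hφ : IsTestFunction Ω φ) (μ : Measure (Euc d)) [IsFiniteMeasureOnCompacts μ] :
    MemLp φ 2 μ := hφ.smooth.continuous.memLp_of_hasCompactSupport hφ.compact

theorem IsTestFunction.differentiable {Ω : Set (Euc d)} {φ : Euc d → ℂ}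
    (hφ : IsTestFunction Ω φ) : Differentiable ℝ φ := hφ.smooth.differentiable (by simp)

theorem partialDeriv_add {φ ψ : Euc d → ℂ} (hφ : Differentiable ℝ φ) (hψ : Differentiable ℝ ψ)
    (i : Fin d) (x : Euc d) :
    partialDeriv i (φ + ψ) x = partialDeriv i φ x + partialDeriv i ψ x := by
  simp [partialDeriv, fderiv_add (hφ x) (hψ x)]

theorem partialDeriv_smul {φ : Euc d → ℂ} (hφ : Differentiable ℝ φ) (c : ℂ)
    (i : Fin d) (x : Euc d) : partialDeriv i (c • φ) x = c * partialDeriv i φ x := by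
  simp [partialDeriv, fderiv_const_smul (hφ x)]

theorem partialDeriv_mul {φ ψ : Euc d → ℂ} (hφ : Differentiable ℝ φ) (hψ : Differentiable ℝ ψ)
    (i : Fin d) (x : Euc d) : partialDeriv i (fun y => φ y * ψ y) x =
      φ x * partialDeriv i ψ x + partialDeriv i φ x * ψ x := by
  simp only [partialDeriv]
  rw [fderiv_fun_mul (hφ x) (hψ x)]
  simp [mul_comm]

theorem integral_mul_partialDeriv {Ω : Set (Euc d)} {φ ψ : Euc d → ℂ}
    (hφ : IsTestFunction Set.univ φ) (hψ : IsTestFunction Ω ψ) (i : Fin d) :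
    ∫ x in Ω, φ x * partialDeriv i ψ x = - ∫ x in Ω, partialDeriv i φ x * ψ x := by
  rw [setIntegral_eq_integral_of_forall_compl_eq_zero, setIntegral_eq_integral_of_forall_compl_eq_zero]
  · refine integral_mul_fderiv_eq_neg_fderiv_mul_of_integrable ?_ ?_ ?_
      (fun x _ => hφ.differentiable x) (fun x _ => hψ.differentiable x)
    · exact ((hφ.continuous_partialDeriv i).mul hψ.smooth.continuous).integrable_of_hasCompactSupport
        hψ.compact.mul_left
    · exact (hφ.smooth.continuous.mul
        (hψ.continuous_partialDeriv i)).integrable_of_hasCompactSupport hφ.compact.mul_right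
    · exact (hφ.smooth.continuous.mul hψ.smooth.continuous).integrable_of_hasCompactSupport
        hφ.compact.mul_right
  · intro x hx
    rw [image_eq_zero_of_notMem_tsupport fun h => hx (hψ.subset h), mul_zero]
  · intro x hx
    rw [image_eq_zero_of_notMem_tsupport
      fun h => hx (hψ.subset (tsupport_partialDeriv_subset i ψ h)), mul_zero]

/-- An element of `H¹(Ω)` given by functions. -/
def mkH1 {Ω : Set (Euc d)} (f : Euc d → ℂ) (G : Euc d → EuclideanSpace ℂ (Fin d))
    (hf : MemLp f 2 (volume.restrict Ω)) (hG : MemLp G 2 (volume.restrict Ω))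
    (h : ∀ φ : Euc d → ℂ, IsTestFunction Ω φ → ∀ i : Fin d,
      ∫ x in Ω, f x * partialDeriv i φ x = - ∫ x in Ω, G x i * φ x) : H1 Ω :=
  ⟨WithLp.toLp 2 (hf.toLp f, hG.toLp G), fun φ hφ i => by
    have h1 : ∫ x in Ω, hf.toLp f x * partialDeriv i φ x = ∫ x in Ω, f x * partialDeriv i φ x := by
      refine integral_congr_ae ?_
      filter_upwards [hf.coeFn_toLp] with x hx
      rw [hx]
    have h2 : ∫ x in Ω, hG.toLp G x i * φ x = ∫ x in Ω, G x i * φ x := by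
      refine integral_congr_ae ?_
      filter_upwards [hG.coeFn_toLp] with x hx
      rw [hx]
    exact h1.trans ((h φ hφ i).trans (congrArg _ h2.symm))⟩

theorem H1.ext {Ω : Set (Euc d)} {u v : H1 Ω} (h1 : toL2 u = toL2 v) (h2 : grad u = grad v) :
    u = v := by
  have : ‖u - v‖ ^ 2 = 0 := by rw [norm_sq_eq, map_sub, map_sub, h1, h2]; simp
  exact sub_eq_zero.mp (norm_eq_zero.mp (pow_eq_zero_iff two_ne_zero |>.mp this))

theorem isTestFunction_coe (φ : testSpace d) : IsTestFunction Set.univ (φ : Euc d → ℂ) := φ.2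

/-- The restriction of a function in `C_c^∞(ℝ^d)` to `Ω`, as an element of `H¹(Ω)`. -/
def testH1 (Ω : Set (Euc d)) : testSpace d →ₗ[ℂ] H1 Ω where
  toFun φ := mkH1 (φ : Euc d → ℂ) (gradFun φ) ((isTestFunction_coe φ).memLp' _)
    ((isTestFunction_coe φ).memLp_gradFun _)
    fun _ hψ i => integral_mul_partialDeriv (isTestFunction_coe φ) hψ i
  map_add' φ ψ := by
    have h : ((isTestFunction_coe (φ + ψ)).memLp_gradFun (volume.restrict Ω)).toLp _ =
        ((isTestFunction_coe φ).memLp_gradFun (volume.restrict Ω)).toLp _ +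
        ((isTestFunction_coe ψ).memLp_gradFun (volume.restrict Ω)).toLp _ := by
      rw [← MemLp.toLp_add]
      congr 1
      ext x i
      exact partialDeriv_add (isTestFunction_coe φ).differentiable
        (isTestFunction_coe ψ).differentiable i x
    exact H1.ext rfl h
  map_smul' c φ := by
    have h : ((isTestFunction_coe (c • φ)).memLp_gradFun (volume.restrict Ω)).toLp _ =
        c • ((isTestFunction_coe φ).memLp_gradFun (volume.restrict Ω)).toLp _ := by
      rw [← MemLp.toLp_const_smul]
      congr 1
      ext x i
      exact partialDeriv_smul (isTestFunction_coe φ).differentiable c i x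
    exact H1.ext rfl h

theorem toL2_testH1 {Ω : Set (Euc d)} (φ : testSpace d) :
    toL2 (testH1 Ω φ) =ᵐ[volume.restrict Ω] φ.1 :=
  ((isTestFunction_coe φ).memLp' (volume.restrict Ω)).coeFn_toLp

theorem grad_testH1 {Ω : Set (Euc d)} (φ : testSpace d) :
    grad (testH1 Ω φ) =ᵐ[volume.restrict Ω] gradFun φ.1 :=
  ((isTestFunction_coe φ).memLp_gradFun (volume.restrict Ω)).coeFn_toLp

/-- This is density of `H¹(Ω)` in `L²(Ω)`, needed for the Robin graph to be single-valued. -/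
theorem eq_zero_of_forall_inner_toL2 {Ω : Set (Euc d)} (hΩ : IsOpen Ω) {h : L2 Ω}
    (hh : ∀ u : H1 Ω, inner ℂ (toL2 u) h = 0) : h = 0 := by
  rw [Lp.eq_zero_iff_ae_eq_zero]
  refine ae_eq_zero_of_forall_integral_mul hΩ (Lp.memLp h) fun φ hφ => ?_
  have hφ' : IsTestFunction Set.univ fun x => starRingEnd ℂ (φ x) :=
    ⟨Complex.conjCLE.contDiff.comp hφ.smooth, hφ.compact.comp_left (by simp), Set.subset_univ _⟩
  rw [← hh (testH1 Ω ⟨_, hφ'⟩), L2.inner_def]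
  refine integral_congr_ae ?_
  filter_upwards [toL2_testH1 (Ω := Ω) ⟨_, hφ'⟩] with x hx
  rw [hx]
  simp

/-! ### Restriction to smaller sets -/

/-- Restriction of functions in `L²(ℝ^d; F)` to `Ω`. -/
def restrLp {F : Type*} [NormedAddCommGroup F] [NormedSpace ℂ F] (Ω : Set (Euc d)) :
    Lp F 2 (volume.restrict (Set.univ : Set (Euc d))) →ₗ[ℂ] Lp F 2 (volume.restrict Ω) where
  toFun f := ((Lp.memLp f).mono_measure (Measure.restrict_mono Ω.subset_univ le_rfl)).toLp f
  map_add' f g := by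
    rw [← MemLp.toLp_add, MemLp.toLp_eq_toLp_iff]
    exact ae_mono (Measure.restrict_mono Ω.subset_univ le_rfl) (Lp.coeFn_add f g)
  map_smul' c f := by
    rw [RingHom.id_apply, ← MemLp.toLp_const_smul, MemLp.toLp_eq_toLp_iff]
    exact ae_mono (Measure.restrict_mono Ω.subset_univ le_rfl) (Lp.coeFn_smul c f)

theorem restrLp_ae {F : Type*} [NormedAddCommGroup F] [NormedSpace ℂ F] (Ω : Set (Euc d))
    (f : Lp F 2 (volume.restrict (Set.univ : Set (Euc d)))) :
    restrLp Ω f =ᵐ[volume.restrict Ω] f :=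
  ((Lp.memLp f).mono_measure (Measure.restrict_mono Ω.subset_univ le_rfl)).coeFn_toLp

/-- The restriction of `u ∈ H¹(ℝ^d)` to `Ω`. -/
def restr (Ω : Set (Euc d)) : H1 (Set.univ : Set (Euc d)) →ₗ[ℂ] H1 Ω where
  toFun u := mkH1 (toL2 u) (grad u)
    ((Lp.memLp (toL2 u)).mono_measure (Measure.restrict_mono Ω.subset_univ le_rfl))
    ((Lp.memLp (grad u)).mono_measure (Measure.restrict_mono Ω.subset_univ le_rfl))
    fun φ hφ i => by
      have := isWeakGradient u φ (hφ.mono Ω.subset_univ) i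
      rw [setIntegral_eq_of_subset_of_forall_sdiff_eq_zero MeasurableSet.univ Ω.subset_univ,
        setIntegral_eq_of_subset_of_forall_sdiff_eq_zero MeasurableSet.univ Ω.subset_univ] at this
      · exact this
      · intro x hx
        rw [image_eq_zero_of_notMem_tsupport fun h => hx.2 (hφ.subset h), mul_zero]
      · intro x hx
        rw [image_eq_zero_of_notMem_tsupport
          fun h => hx.2 (hφ.subset (tsupport_partialDeriv_subset i φ h)), mul_zero]
  map_add' u v := H1.ext ((restrLp Ω).map_add (toL2 u) (toL2 v))
    ((restrLp Ω).map_add (grad u) (grad v))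
  map_smul' c u := H1.ext ((restrLp Ω).map_smul c (toL2 u)) ((restrLp Ω).map_smul c (grad u))

theorem toL2_restr (Ω : Set (Euc d)) (u : H1 (Set.univ : Set (Euc d))) :
    toL2 (restr Ω u) = restrLp Ω (toL2 u) := rfl

theorem grad_restr (Ω : Set (Euc d)) (u : H1 (Set.univ : Set (Euc d))) :
    grad (restr Ω u) = restrLp Ω (grad u) := rfl

theorem norm_sq_eq_lintegral {F : Type*} [NormedAddCommGroup F] {μ : Measure (Euc d)}
    (f : Lp F 2 μ) : ‖f‖ ^ 2 = (∫⁻ x, ‖f x‖ₑ ^ 2 ∂μ).toReal := by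
  rw [Lp.norm_def, eLpNorm_eq_lintegral_rpow_enorm_toReal (by norm_num) (by norm_num),
    ← ENNReal.toReal_pow]
  congr 1
  rw [← ENNReal.rpow_natCast, ← ENNReal.rpow_mul]
  norm_num

theorem lintegral_enorm_sq_ne_top {F : Type*} [NormedAddCommGroup F] {μ : Measure (Euc d)}
    {f : Euc d → F} (hf : MemLp f 2 μ) : ∫⁻ x, ‖f x‖ₑ ^ 2 ∂μ ≠ ⊤ := by
  have := (lintegral_rpow_enorm_lt_top_of_eLpNorm_lt_top (by norm_num) (by norm_num) hf.2).ne
  simpa using this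

/-- An inequality is enough for the main estimate, so it need not be known that `∂Ω` is a Lebesgue
null set. -/
theorem norm_restrLp_sq_add_le {F : Type*} [NormedAddCommGroup F] [NormedSpace ℂ F]
    {A B : Set (Euc d)} (hB : MeasurableSet B) (hAB : Disjoint A B)
    (f : Lp F 2 (volume.restrict (Set.univ : Set (Euc d)))) :
    ‖restrLp A f‖ ^ 2 + ‖restrLp B f‖ ^ 2 ≤ ‖f‖ ^ 2 := by
  have key : ∀ A : Set (Euc d),
      ∫⁻ x in A, ‖restrLp A f x‖ₑ ^ 2 = ∫⁻ x in A, ‖f x‖ₑ ^ 2 := fun A => by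
    refine lintegral_congr_ae ?_
    filter_upwards [restrLp_ae A f] with x hx
    rw [hx]
  have hfin : ∫⁻ x in Set.univ, ‖f x‖ₑ ^ 2 ≠ ⊤ := lintegral_enorm_sq_ne_top (Lp.memLp f)
  have hle : ∀ A : Set (Euc d), ∫⁻ x in A, ‖f x‖ₑ ^ 2 ≤ ∫⁻ x in Set.univ, ‖f x‖ₑ ^ 2 :=
    fun A => lintegral_mono_set A.subset_univ
  rw [norm_sq_eq_lintegral, norm_sq_eq_lintegral, norm_sq_eq_lintegral, key, key,
    ← ENNReal.toReal_add (ne_top_of_le_ne_top hfin (hle A)) (ne_top_of_le_ne_top hfin (hle B)),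
    ← lintegral_union hB hAB]
  exact ENNReal.toReal_mono hfin (hle _)

theorem norm_restr_sq_add_le {A B : Set (Euc d)} (hB : MeasurableSet B) (hAB : Disjoint A B)
    (u : H1 (Set.univ : Set (Euc d))) : ‖restr A u‖ ^ 2 + ‖restr B u‖ ^ 2 ≤ ‖u‖ ^ 2 := by
  rw [norm_sq_eq, norm_sq_eq, norm_sq_eq u, toL2_restr, toL2_restr, grad_restr, grad_restr]
  have h1 := norm_restrLp_sq_add_le hB hAB (toL2 u)
  have h2 := norm_restrLp_sq_add_le hB hAB (grad u)
  linarith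

theorem norm_restr_le (A : Set (Euc d)) (u : H1 (Set.univ : Set (Euc d))) :
    ‖restr A u‖ ≤ ‖u‖ := by
  have := norm_restr_sq_add_le MeasurableSet.empty (Set.disjoint_empty A) u
  exact (abs_le_of_sq_le_sq' (by nlinarith [sq_nonneg ‖restr ∅ u‖]) (norm_nonneg _)).2

theorem continuous_restr (A : Set (Euc d)) : Continuous (restr A) :=
  AddMonoidHomClass.continuous_of_bound (restr A) 1 fun u => by simpa using norm_restr_le A u

theorem restr_testH1 (A : Set (Euc d)) (φ : testSpace d) :
    restr A (testH1 Set.univ φ) = testH1 A φ := by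
  have h := Measure.restrict_mono (μ := volume) A.subset_univ le_rfl
  refine H1.ext (Lp.ext ?_) (Lp.ext ?_)
  · filter_upwards [restrLp_ae A (toL2 (testH1 Set.univ φ)), toL2_testH1 (Ω := A) φ,
      ae_mono h (toL2_testH1 φ)] with x h1 h2 h3
    rw [h2, ← h3, ← h1, toL2_restr]
  · filter_upwards [restrLp_ae A (grad (testH1 Set.univ φ)), grad_testH1 (Ω := A) φ,
      ae_mono h (grad_testH1 φ)] with x h1 h2 h3
    rw [h2, ← h3, ← h1, grad_restr]

theorem restr_extension {Ω : Set (Euc d)} (hΩ : IsOpen Ω)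
    {E : H1 Ω →L[ℂ] H1 (Set.univ : Set (Euc d))} (hE : IsExtensionOperator E) (f : H1 Ω) :
    restr Ω (E f) = f :=
  toL2_injective hΩ (Lp.ext ((restrLp_ae Ω _).trans (hE f)))

/-! ### Convolution with approximate identities in `L²` -/

/-- Translations act continuously on `L²`, and the integral is an inner product with a translate. -/
theorem continuous_integral_mul_translate {a b : Euc d → ℂ} (ha : MemLp a 2 volume)
    (hb : MemLp b 2 volume) : Continuous fun t : Euc d => ∫ x, a x * b (x - t) := by
  have h2 : Fact ((2 : ℝ≥0∞) ≠ ⊤) := ⟨by norm_num⟩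
  have hc : Continuous fun t : Euc d => DomAddAct.mk (-t) +ᵥ hb.toLp b :=
    (DomAddAct.continuous_mk.comp continuous_neg).vadd continuous_const
  have heq : (fun t : Euc d => ∫ x, a x * b (x - t)) = fun t : Euc d =>
      inner ℂ ((memLp_conj ha).toLp _) (DomAddAct.mk (-t) +ᵥ hb.toLp b) := by
    ext t
    rw [DomAddAct.mk_vadd_toLp, L2.inner_def]
    have h3 : (MemLp.toLp (fun x => b (-t +ᵥ x))
        (hb.comp_measurePreserving (measurePreserving_vadd (-t) volume)) : Euc d → ℂ) =ᵐ[volume]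
        fun x => b (-t +ᵥ x) := MemLp.coeFn_toLp _
    refine integral_congr_ae ?_
    filter_upwards [(memLp_conj ha).coeFn_toLp, h3] with x h1 h2
    rw [h1, h2]
    simp [mul_comm, sub_eq_neg_add]
  rw [heq]
  exact continuous_const.inner hc

/-- Fubini after the substitution `t = x - y`. Integrability on the product follows from `|a(x) b(x
- t)| ≤ |a(x)|² + |b(x - t)|²` and translation invariance. -/
theorem integral_mul_convolution {a b : Euc d → ℂ} (ha : MemLp a 2 volume)
    (hb : MemLp b 2 volume) {η : Euc d → ℝ} (hη : Continuous η) (hc : HasCompactSupport η) :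
    ∫ x, a x * ∫ y, b y * (η (x - y) : ℂ) = ∫ t, η t • ∫ x, a x * b (x - t) := by
  have hη1 : Integrable η := hη.integrable_of_hasCompactSupport hc
  have hbt : ∀ t : Euc d, MemLp (fun x => b (x - t)) 2 volume := fun t =>
    hb.comp_measurePreserving (measurePreserving_sub_right volume t)
  have hm : AEStronglyMeasurable (fun p : Euc d × Euc d => a p.1 * b (p.1 - p.2) * (η p.2 : ℂ))
      (volume.prod volume) := by
    refine (ha.1.comp_fst.mul ?_).mul ?_
    · exact hb.1.comp_quasiMeasurePreserving
        (quasiMeasurePreserving_sub_of_right_invariant volume volume)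
    · exact (Complex.continuous_ofReal.comp (hη.comp continuous_snd)).aestronglyMeasurable
  have hint : Integrable (fun p : Euc d × Euc d => a p.1 * b (p.1 - p.2) * (η p.2 : ℂ))
      (volume.prod volume) := by
    rw [integrable_prod_iff' hm]
    refine ⟨Eventually.of_forall fun t =>
      (ha.integrable_mul (hbt t)).mul_const (η t : ℂ), ?_⟩
    refine Integrable.mono' ((hη1.norm).const_mul
      ((∫ x, ‖a x‖ ^ 2) + ∫ x, ‖b x‖ ^ 2)) hm.norm.prod_swap.integral_prod_right'
      (Eventually.of_forall fun t => ?_)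
    simp only [norm_mul]
    rw [integral_mul_const, Complex.norm_real, norm_mul, norm_norm]
    refine mul_le_mul_of_nonneg_right ?_ (norm_nonneg _)
    rw [Real.norm_of_nonneg (integral_nonneg fun x => by positivity)]
    have ha2 := (memLp_two_iff_integrable_sq_norm ha.1).mp ha
    have hb2 := (memLp_two_iff_integrable_sq_norm (hbt t).1).mp (hbt t)
    rw [← integral_sub_right_eq_self (fun x => ‖b x‖ ^ 2) t, ← integral_add ha2 hb2]
    refine integral_mono_of_nonneg (Eventually.of_forall fun x => by positivity)
      (ha2.add hb2) (Eventually.of_forall fun x => ?_)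
    have h1 := sq_nonneg (‖a x‖ - ‖b (x - t)‖)
    have h2 := mul_nonneg (norm_nonneg (a x)) (norm_nonneg (b (x - t)))
    nlinarith
  calc ∫ x, a x * ∫ y, b y * (η (x - y) : ℂ)
      = ∫ x, ∫ t, a x * b (x - t) * (η t : ℂ) := by
        congr 1
        ext x
        rw [← integral_const_mul, ← integral_sub_left_eq_self _ volume x]
        congr 1
        ext t
        simp [mul_assoc]
    _ = ∫ t, ∫ x, a x * b (x - t) * (η t : ℂ) := integral_integral_swap hint
    _ = _ := by
        congr 1
        ext t
        rw [integral_mul_const, Complex.real_smul, mul_comm]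

/-- Only weak convergence of the mollifications is needed, because density is proved through
orthogonality. -/
theorem tendsto_integral_mul_convolution {a b : Euc d → ℂ} (ha : MemLp a 2 volume)
    (hb : MemLp b 2 volume) {η : ℕ → Euc d → ℝ} (hη : ∀ n, Continuous (η n))
    (hc : ∀ n, HasCompactSupport (η n)) (h0 : ∀ n x, 0 ≤ η n x) (h1 : ∀ n, ∫ x, η n x = 1)
    (hs : Tendsto (fun n => Function.support (η n)) atTop (𝓝 0).smallSets) :
    Tendsto (fun n => ∫ x, a x * ∫ y, b y * (η n (x - y) : ℂ)) atTop
      (𝓝 (∫ x, a x * b x)) := by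
  have hcont := continuous_integral_mul_translate ha hb
  have hcont' := hcont.comp continuous_neg
  -- The double sign in `x - -t` compensates for the reflection in the convolution evaluated at the
  -- origin.
  have := convolution_tendsto_right (μ := volume) (φ := η) (l := atTop) (x₀ := (0 : Euc d))
    (k := fun _ => 0) (g := fun _ t => ∫ x, a x * b (x - -t)) (z₀ := ∫ x, a x * b x)
    (Eventually.of_forall h0) (Eventually.of_forall h1) hs
    (Eventually.of_forall fun _ => hcont'.aestronglyMeasurable)
    ((by simpa [Function.comp_def] using hcont'.tendsto 0 :
      Tendsto (fun t => ∫ x, a x * b (x - -t)) (𝓝 (0 : Euc d)) (𝓝 (∫ x, a x * b x))).comp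
      tendsto_snd)
    tendsto_const_nhds
  refine this.congr fun n => ?_
  rw [integral_mul_convolution ha hb (hη n) (hc n), convolution_def]
  simp

theorem memLp_mul_compactSupport {μ : Measure (Euc d)} {f χ : Euc d → ℂ} (hf : MemLp f 2 μ)
    (hχ : Continuous χ) (hχc : HasCompactSupport χ) : MemLp (fun x => χ x * f x) 2 μ := by
  obtain ⟨C, hC⟩ := hχ.bounded_above_of_compact_support hχc
  refine MemLp.of_le_mul (c := C) hf (hχ.aestronglyMeasurable.mul hf.1)
    (Eventually.of_forall fun x => ?_)
  rw [norm_mul]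
  gcongr
  exact hC x

/-! ### Density of `C_c^∞(ℝ^d)` -/

/-- Near every point, translations by the vectors of a truncated open cone do not leave `Ω`. -/
def HasLocalCone (Ω : Set (Euc d)) : Prop :=
  ∀ x₀ : Euc d, ∃ (ρ : ℝ) (e : Euc d) (r : ℝ), 0 < ρ ∧ 0 < r ∧
    ∀ x ∈ Ω, x ∈ Metric.ball x₀ ρ → ∀ s : ℝ, 0 < s → s ≤ 1 →
      ∀ y ∈ Metric.ball x₀ ρ, y - x ∈ Metric.closedBall (s • e) (s * r) → y ∈ Ω

theorem inner_toL2_eq {Ω : Set (Euc d)} (f g : L2 Ω) :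
    inner ℂ f g = ∫ x in Ω, starRingEnd ℂ (f x) * g x := by
  rw [L2.inner_def]
  congr 1
  ext x
  simp [mul_comm]

theorem inner_L2Vec_eq {Ω : Set (Euc d)} (F G : L2Vec Ω) :
    inner ℂ F G = ∑ i, ∫ x in Ω, starRingEnd ℂ (F x i) * G x i := by
  rw [L2.inner_def, ← integral_finsetSum]
  · congr 1
    ext x
    simp [PiLp.inner_apply, mul_comm]
  · intro i _
    exact (memLp_conj (coord_memLp F i)).integrable_mul (coord_memLp G i)

theorem inner_testH1_eq {Ω : Set (Euc d)} (w : H1 Ω) (φ : testSpace d) :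
    inner ℂ w (testH1 Ω φ) = (∫ x in Ω, starRingEnd ℂ (toL2 w x) * (φ : Euc d → ℂ) x) +
      ∑ i, ∫ x in Ω, starRingEnd ℂ (grad w x i) * partialDeriv i φ x := by
  rw [inner_eq, inner_toL2_eq, inner_L2Vec_eq]
  congr 1
  · refine integral_congr_ae ?_
    filter_upwards [toL2_testH1 (Ω := Ω) φ] with x hx
    rw [hx]
  · refine Finset.sum_congr rfl fun i _ => integral_congr_ae ?_
    filter_upwards [grad_testH1 (Ω := Ω) φ] with x hx
    rw [hx]
    rfl

/-- The inner product `(w, ψ u)_{H¹(Ω)}`. -/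
def innerMul {Ω : Set (Euc d)} (w u : H1 Ω) (ψ : Euc d → ℂ) : ℂ :=
  (∫ x in Ω, starRingEnd ℂ (toL2 w x) * (ψ x * toL2 u x)) +
    ∑ i, ∫ x in Ω, starRingEnd ℂ (grad w x i) *
      (partialDeriv i ψ x * toL2 u x + ψ x * grad u x i)

theorem partialDeriv_convolution {b : Euc d → ℂ} (hb : LocallyIntegrable b volume)
    {K : Euc d → ℂ} (hK : IsTestFunction Set.univ K) (i : Fin d) (x : Euc d) :
    partialDeriv i (fun x => ∫ y, b y * K (x - y)) x = ∫ y, b y * partialDeriv i K (x - y) := by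
  have h := hK.compact.hasFDerivAt_convolution_right (ContinuousLinearMap.mul ℝ ℂ) hb
    (hK.smooth.of_le (by simp)) x
  have h' : HasFDerivAt (fun x => ∫ y, b y * K (x - y)) _ x := h
  rw [partialDeriv, h'.fderiv, convolution_def, ContinuousLinearMap.integral_apply]
  · rfl
  · exact (hK.compact.fderiv ℝ).convolutionExists_right _ hb
      (hK.smooth.continuous_fderiv (by simp)) x

theorem isTestFunction_convolution {b : Euc d → ℂ} (hb : LocallyIntegrable b volume)
    (hc : HasCompactSupport b) {K : Euc d → ℂ} (hK : IsTestFunction Set.univ K) :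
    IsTestFunction Set.univ (fun x => ∫ y, b y * K (x - y)) :=
  ⟨hK.compact.contDiff_convolution_right (ContinuousLinearMap.mul ℝ ℂ) hb hK.smooth,
    hc.convolution (ContinuousLinearMap.mul ℝ ℂ) hK.compact, Set.subset_univ _⟩

/-- The zero extension of `ψ u` is mollified with kernels shifted off the origin, so that at `x ∈ Ω`
only values at points of `x` plus a small truncated cone enter. By the cone condition these points
stay in `Ω`, hence on `Ω` differentiation commutes with the mollification and no boundary term
appears. The mollified functions are smooth with compact support, thus orthogonal to `w`, and so is
their weak limit `ψ u`. -/
theorem innerMul_eq_zero_of_tsupport_subset_ball {Ω : Set (Euc d)} (hΩ : IsOpen Ω) {w : H1 Ω}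
    (hw : ∀ φ, inner ℂ w (testH1 Ω φ) = 0) (u : H1 Ω) {x₀ e : Euc d} {ρ r : ℝ} (hρ : 0 < ρ)
    (hr : 0 < r)
    (hcone : ∀ x ∈ Ω, x ∈ Metric.ball x₀ ρ → ∀ s : ℝ, 0 < s → s ≤ 1 →
      ∀ y ∈ Metric.ball x₀ ρ, y - x ∈ Metric.closedBall (s • e) (s * r) → y ∈ Ω)
    {ψ : Euc d → ℂ} (hψ : IsTestFunction Set.univ ψ)
    (hsupp : tsupport ψ ⊆ Metric.ball x₀ (ρ / 2)) : innerMul w u ψ = 0 := by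
  have hρe : 0 < ‖e‖ + r := by positivity
  -- With this bound the kernels displace points by at most `ρ / 2`, so a point that sees the
  -- support of `ψ` still lies in the ball of radius `ρ`.
  set s₀ : ℝ := min 1 (ρ / (2 * (‖e‖ + r))) with hs₀
  have hs₀0 : 0 < s₀ := by positivity
  have hs₀ρ : s₀ * (‖e‖ + r) ≤ ρ / 2 := by
    calc s₀ * (‖e‖ + r) ≤ ρ / (2 * (‖e‖ + r)) * (‖e‖ + r) := by
          gcongr; exact min_le_right _ _
      _ = ρ / 2 := by field_simp
  set s : ℕ → ℝ := fun n => s₀ / (n + 1) with hs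
  have hs0 : ∀ n, 0 < s n := fun n => by positivity
  have hss : ∀ n, s n ≤ s₀ := fun n => div_le_self hs₀0.le (by linarith [n.cast_nonneg (α := ℝ)])
  have hslim : Tendsto s atTop (𝓝 0) :=
    tendsto_const_div_atTop_nhds_zero_nat s₀ |>.comp (tendsto_add_atTop_nat 1) |>.congr
      fun n => by simp [hs]
  -- The centre is `-(s n • e)` because the kernel is evaluated at `x - y`; the sampled points
  -- satisfy `y - x ∈ closedBall (s n • e) (s n * r)`.
  let K : (n : ℕ) → ContDiffBump (-(s n • e)) := fun n =>
    ⟨s n * r / 2, s n * r, by have := hs0 n; positivity, by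
      have := mul_pos (hs0 n) hr; linarith⟩
  let η : ℕ → Euc d → ℝ := fun n => (K n).normed volume
  have hηs : ∀ n x, η n x ≠ 0 → x ∈ Metric.closedBall (-(s n • e)) (s n * r) := fun n x hx =>
    Metric.ball_subset_closedBall ((K n).support_normed_eq (μ := volume) ▸ hx)
  have hηsm : Tendsto (fun n => Function.support (η n)) atTop (𝓝 0).smallSets := by
    rw [tendsto_smallSets_iff]
    intro t ht
    obtain ⟨ε, hε, hεt⟩ := Metric.mem_nhds_iff.mp ht
    have : Tendsto (fun n => s n * (‖e‖ + r)) atTop (𝓝 0) := by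
      simpa using hslim.mul_const (‖e‖ + r)
    filter_upwards [this.eventually_lt_const hε] with n hn x hx
    refine hεt ?_
    have h1 := hηs n x hx
    rw [Metric.mem_closedBall, dist_eq_norm] at h1
    rw [mem_ball_zero_iff]
    calc ‖x‖ = ‖(x - -(s n • e)) - s n • e‖ := by congr 1; abel
      _ ≤ ‖x - -(s n • e)‖ + ‖s n • e‖ := norm_sub_le _ _
      _ ≤ s n * r + s n * ‖e‖ := by
          rw [norm_smul, Real.norm_of_nonneg (hs0 n).le]; linarith
      _ < ε := by linarith
  have hηt : ∀ n, IsTestFunction Set.univ fun x => (η n x : ℂ) := fun n =>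
    IsTestFunction.ofReal (K n).contDiff_normed (K n).hasCompactSupport_normed (Set.subset_univ _)
  -- the data, extended by zero
  have hext : ∀ f : Euc d → ℂ, MemLp f 2 (volume.restrict Ω) → MemLp (Ω.indicator f) 2 volume :=
    fun f hf => (memLp_indicator_iff_restrict hΩ.measurableSet).mpr hf
  have hmul : ∀ (f g : Euc d → ℂ), ∫ x in Ω, f x * g x = ∫ x, Ω.indicator f x * g x := by
    intro f g
    rw [← integral_indicator hΩ.measurableSet]
    congr 1
    ext x
    by_cases hx : x ∈ Ω <;> simp [hx]
  set b : Euc d → ℂ := Ω.indicator fun x => ψ x * toL2 u x with hb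
  set bi : Fin d → Euc d → ℂ := fun i => Ω.indicator fun x =>
    partialDeriv i ψ x * toL2 u x + ψ x * grad u x i with hbi
  have hbL : MemLp b 2 volume := hext _ (memLp_mul_compactSupport (Lp.memLp _) hψ.smooth.continuous hψ.compact)
  have hbiL : ∀ i, MemLp (bi i) 2 volume := fun i => hext _
    ((memLp_mul_compactSupport (Lp.memLp _) (hψ.continuous_partialDeriv i) (hψ.hasCompactSupport_partialDeriv i)).add
      (memLp_mul_compactSupport (coord_memLp _ i) hψ.smooth.continuous hψ.compact))
  have hbloc : LocallyIntegrable b volume := hbL.locallyIntegrable (by norm_num)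
  have hbc : HasCompactSupport b := by
    refine HasCompactSupport.intro hψ.compact fun x hx => ?_
    by_cases hxΩ : x ∈ Ω <;> simp [hb, hxΩ, image_eq_zero_of_notMem_tsupport hx]
  have hΦ : ∀ n, IsTestFunction Set.univ fun x => ∫ y, b y * (η n (x - y) : ℂ) := fun n =>
    isTestFunction_convolution hbloc hbc (hηt n)
  have hdΦ : ∀ n i, ∀ x ∈ Ω, partialDeriv i (fun x => ∫ y, b y * (η n (x - y) : ℂ)) x =
      ∫ y, bi i y * (η n (x - y) : ℂ) := by
    intro n i x hx
    rw [partialDeriv_convolution hbloc (hηt n)]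
    -- For fixed `x ∈ Ω` this is an admissible test function in `Ω`. The weak gradient identity for
    -- `u` tested with it moves the derivative from the kernel onto `ψ u`.
    let θ : Euc d → ℂ := fun y => (η n (x - y) : ℂ) * ψ y
    have hsub : ContDiff ℝ ∞ fun y : Euc d => (η n (x - y) : ℂ) :=
      (hηt n).smooth.comp (contDiff_const.sub contDiff_id)
    have hθ : IsTestFunction Ω θ := by
      refine ⟨hsub.mul hψ.smooth, hψ.compact.mul_left, fun y hy => ?_⟩
      have hy1 : y ∈ tsupport ψ := tsupport_mul_subset_right hy
      have hy2 : x - y ∈ Metric.closedBall (-(s n • e)) (s n * r) := by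
        have hcl : IsClosed {y | x - y ∈ Metric.closedBall (-(s n • e)) (s n * r)} :=
          Metric.isClosed_closedBall.preimage (continuous_const.sub continuous_id)
        refine closure_minimal ?_ hcl hy
        intro z hz
        refine hηs n _ fun h0 => hz ?_
        simp [θ, h0]
      have hy2' : ‖(y - x) - s n • e‖ ≤ s n * r := by
        rw [Metric.mem_closedBall, dist_eq_norm] at hy2
        rwa [← norm_neg, show -(y - x - s n • e) = x - y - -(s n • e) by abel]
      have hyx : ‖y - x‖ ≤ ρ / 2 := by
        calc ‖y - x‖ = ‖((y - x) - s n • e) + s n • e‖ := by congr 1; abel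
          _ ≤ ‖(y - x) - s n • e‖ + ‖s n • e‖ := norm_add_le _ _
          _ ≤ s n * r + s n * ‖e‖ := by
            rw [norm_smul, Real.norm_of_nonneg (hs0 n).le]; linarith
          _ = s n * (‖e‖ + r) := by ring
          _ ≤ s₀ * (‖e‖ + r) := by gcongr; exact hss n
          _ ≤ ρ / 2 := hs₀ρ
      have hyb := hsupp hy1
      have hxb : x ∈ Metric.ball x₀ ρ := by
        rw [Metric.mem_ball] at hyb ⊢
        calc dist x x₀ ≤ dist x y + dist y x₀ := dist_triangle _ _ _
          _ < ρ / 2 + ρ / 2 := by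
            rw [dist_comm x y, dist_eq_norm]; linarith
          _ = ρ := by ring
      exact hcone x hx hxb (s n) (hs0 n) ((hss n).trans (min_le_left _ _)) y
        (Metric.ball_subset_ball (by linarith) hyb) (by rwa [Metric.mem_closedBall, dist_eq_norm])
    have hdθ : ∀ y, partialDeriv i θ y = (η n (x - y) : ℂ) * partialDeriv i ψ y -
        partialDeriv i (fun x => (η n x : ℂ)) (x - y) * ψ y := by
      intro y
      rw [partialDeriv_mul (hsub.differentiable (by simp)) hψ.differentiable]
      suffices h : partialDeriv i (fun y => (η n (x - y) : ℂ)) y =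
          -partialDeriv i (fun x => (η n x : ℂ)) (x - y) by rw [h]; ring
      have h1 : HasFDerivAt (fun y : Euc d => x - y) (-ContinuousLinearMap.id ℝ (Euc d)) y :=
        (hasFDerivAt_id y).const_sub x
      have h2 := ((hηt n).differentiable (x - y)).hasFDerivAt.comp y h1
      have h2' : HasFDerivAt (fun y : Euc d => (η n (x - y) : ℂ)) _ y := h2
      rw [partialDeriv, h2'.fderiv]
      simp [partialDeriv]
    have hηψ : MemLp (fun y => (η n (x - y) : ℂ) * partialDeriv i ψ y) 2 (volume.restrict Ω) :=
      ((hsub.continuous.mul (hψ.continuous_partialDeriv i)).memLp_of_hasCompactSupport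
        (hψ.hasCompactSupport_partialDeriv i).mul_left).restrict Ω
    have hweak := isWeakGradient u θ hθ i
    rw [hbi, hb, ← hmul, ← hmul]
    have e1 : ∫ y in Ω, ψ y * toL2 u y * partialDeriv i (fun x => (η n x : ℂ)) (x - y) =
        (∫ y in Ω, toL2 u y * ((η n (x - y) : ℂ) * partialDeriv i ψ y)) -
          ∫ y in Ω, toL2 u y * partialDeriv i θ y := by
      rw [← integral_sub]
      · congr 1
        ext y
        rw [hdθ]
        ring
      · exact (Lp.memLp (toL2 u)).integrable_mul hηψ
      · exact hθ.integrable_left (toL2 u) i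
    rw [e1, hweak, sub_neg_eq_add, ← integral_add]
    · congr 1
      ext y
      simp only [θ]
      ring
    · exact (Lp.memLp (toL2 u)).integrable_mul hηψ
    · exact hθ.integrable_right (grad u) i
  -- orthogonality to the mollified functions
  have hzero : ∀ n, (∫ x, Ω.indicator (fun x => starRingEnd ℂ (toL2 w x)) x *
      ∫ y, b y * (η n (x - y) : ℂ)) + ∑ i, ∫ x, Ω.indicator (fun x => starRingEnd ℂ (grad w x i)) x *
      ∫ y, bi i y * (η n (x - y) : ℂ) = 0 := by
    intro n
    have := hw ⟨_, hΦ n⟩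
    rw [inner_testH1_eq] at this
    rw [← this, ← hmul]
    congr 1
    refine Finset.sum_congr rfl fun i _ => ?_
    rw [← hmul]
    exact setIntegral_congr_fun hΩ.measurableSet fun x hx => by
      simp only [hdΦ n i x hx]
  have hlim := (tendsto_integral_mul_convolution (hext _ (memLp_conj (Lp.memLp (toL2 w)))) hbL
    (fun n => (K n).continuous_normed) (fun n => (K n).hasCompactSupport_normed)
    (fun n => (K n).nonneg_normed) (fun n => (K n).integral_normed) hηsm).add
    (tendsto_finsetSum Finset.univ fun i _ =>
      tendsto_integral_mul_convolution (hext _ (memLp_conj (coord_memLp (grad w) i))) (hbiL i)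
      (fun n => (K n).continuous_normed) (fun n => (K n).hasCompactSupport_normed)
      (fun n => (K n).nonneg_normed) (fun n => (K n).integral_normed) hηsm)
  have hlim0 := tendsto_nhds_unique hlim (tendsto_const_nhds.congr fun n => (hzero n).symm)
  rw [innerMul, ← hlim0]
  have hind : ∀ f g : Euc d → ℂ, ∫ x in Ω, f x * g x =
      ∫ x, Ω.indicator f x * Ω.indicator g x := by
    intro f g
    rw [← integral_indicator hΩ.measurableSet]
    congr 1
    ext x
    by_cases hx : x ∈ Ω <;> simp [hx]
  rw [hind]
  congr 1
  exact Finset.sum_congr rfl fun i _ => hind _ _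

theorem innerMul_finset_sum {Ω : Set (Euc d)} (w u : H1 Ω) {ι : Type*} (s : Finset ι)
    {ψ : ι → Euc d → ℂ} (hψ : ∀ j, IsTestFunction Set.univ (ψ j)) :
    innerMul w u (fun x => ∑ j ∈ s, ψ j x) = ∑ j ∈ s, innerMul w u (ψ j) := by
  have e1 : ∫ x in Ω, starRingEnd ℂ (toL2 w x) * ((∑ j ∈ s, ψ j x) * toL2 u x) =
      ∑ j ∈ s, ∫ x in Ω, starRingEnd ℂ (toL2 w x) * (ψ j x * toL2 u x) := by
    rw [← integral_finsetSum]
    · simp only [Finset.sum_mul, Finset.mul_sum]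
    · intro j _
      exact (memLp_conj (Lp.memLp (toL2 w))).integrable_mul
        (memLp_mul_compactSupport (Lp.memLp _) (hψ j).smooth.continuous (hψ j).compact)
  have e2 : ∀ i, ∫ x in Ω, starRingEnd ℂ (grad w x i) *
      (partialDeriv i (fun x => ∑ j ∈ s, ψ j x) x * toL2 u x + (∑ j ∈ s, ψ j x) * grad u x i) =
      ∑ j ∈ s, ∫ x in Ω, starRingEnd ℂ (grad w x i) *
        (partialDeriv i (ψ j) x * toL2 u x + ψ j x * grad u x i) := by
    intro i
    rw [← integral_finsetSum]
    · have : ∀ x, partialDeriv i (fun x => ∑ j ∈ s, ψ j x) x = ∑ j ∈ s, partialDeriv i (ψ j) x := by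
        intro x
        simp only [partialDeriv]
        rw [fderiv_fun_sum fun j _ => (hψ j).differentiable x]
        simp
      simp only [this, Finset.sum_mul, ← Finset.sum_add_distrib, Finset.mul_sum]
    · intro j _
      exact (memLp_conj (coord_memLp (grad w) i)).integrable_mul
        ((memLp_mul_compactSupport (Lp.memLp _) ((hψ j).continuous_partialDeriv i)
          ((hψ j).hasCompactSupport_partialDeriv i)).add
        (memLp_mul_compactSupport (coord_memLp _ i) (hψ j).smooth.continuous (hψ j).compact))
  simp only [innerMul]
  rw [e1, Finset.sum_congr rfl fun i _ => e2 i, Finset.sum_add_distrib]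
  congr 1
  exact Finset.sum_comm

/-- A smooth partition of unity localizes `ψ` to the balls of the cone condition; only finitely many
members meet the compact support of `ψ`. -/
theorem innerMul_eq_zero {Ω : Set (Euc d)} (hΩ : IsOpen Ω) (hcone : HasLocalCone Ω) {w : H1 Ω}
    (hw : ∀ φ, inner ℂ w (testH1 Ω φ) = 0) (u : H1 Ω)
    {ψ : Euc d → ℂ} (hψ : IsTestFunction Set.univ ψ) : innerMul w u ψ = 0 := by
  choose ρ e r hρ hr hc using hcone
  obtain ⟨f, hf⟩ := SmoothPartitionOfUnity.exists_isSubordinate (modelWithCornersSelf ℝ (Euc d))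
    (isClosed_univ (X := Euc d)) (fun x₀ => Metric.ball x₀ (ρ x₀ / 2))
    (fun x₀ => Metric.isOpen_ball) (fun x _ => Set.mem_iUnion.mpr
      ⟨x, Metric.mem_ball_self (half_pos (hρ x))⟩)
  have hfin := f.locallyFinite.finite_nonempty_inter_compact hψ.compact
  have hfs : ∀ j, ContDiff ℝ ∞ (f j) := fun j => (f j).contMDiff.contDiff
  have ht : ∀ j, IsTestFunction Set.univ fun x => (f j x : ℂ) * ψ x := fun j =>
    ⟨(Complex.ofRealCLM.contDiff.comp (hfs j)).mul hψ.smooth, hψ.compact.mul_left,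
      Set.subset_univ _⟩
  have hsum : ψ = fun x => ∑ j ∈ hfin.toFinset, (f j x : ℂ) * ψ x := by
    ext x
    by_cases hx : x ∈ tsupport ψ
    · rw [← Finset.sum_mul]
      have h1 := f.sum_eq_one (Set.mem_univ x)
      rw [finsum_eq_sum_of_support_subset (s := hfin.toFinset)] at h1
      · rw [← Complex.ofReal_sum, h1]
        simp
      · intro j hj
        rw [Set.Finite.coe_toFinset]
        exact ⟨x, hj, hx⟩
    · simp [image_eq_zero_of_notMem_tsupport hx]
  rw [hsum, innerMul_finset_sum w u _ ht]
  refine Finset.sum_eq_zero fun j _ => ?_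
  refine innerMul_eq_zero_of_tsupport_subset_ball hΩ hw u (hρ j) (hr j) (hc j) (ht j) ?_
  refine (tsupport_mul_subset_left (f := fun x => (f j x : ℂ))).trans (Set.Subset.trans ?_ (hf j))
  exact tsupport_comp_subset Complex.ofReal_zero (f j)

/-- Cutoffs `χ(c x)` with `c → 0` tend to `1` boundedly while their gradients are `O(c)`, so by
dominated convergence `innerMul w w` tends to `‖w‖²`. -/
theorem eq_zero_of_innerMul_self {Ω : Set (Euc d)} {w : H1 Ω}
    (hw : ∀ ψ, IsTestFunction Set.univ ψ → innerMul w w ψ = 0) : w = 0 := by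
  let χ : ContDiffBump (0 : Euc d) := ⟨1, 2, one_pos, one_lt_two⟩
  have hχt : IsTestFunction Set.univ fun x => (χ x : ℂ) :=
    IsTestFunction.ofReal χ.contDiff χ.hasCompactSupport (Set.subset_univ _)
  let c : ℕ → ℝ := fun n => ((n : ℝ) + 1)⁻¹
  have hc0 : ∀ n, 0 < c n := fun n => by positivity
  have hc1 : ∀ n, c n ≤ 1 := fun n => inv_le_one_of_one_le₀ (by linarith [n.cast_nonneg (α := ℝ)])
  have hclim : Tendsto c atTop (𝓝 0) := by
    simpa [c, one_div] using tendsto_one_div_add_atTop_nhds_zero_nat (𝕜 := ℝ)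
  let ψ : ℕ → Euc d → ℂ := fun n x => (χ (c n • x) : ℂ)
  have hψ : ∀ n, IsTestFunction Set.univ (ψ n) := fun n =>
    ⟨hχt.smooth.comp (contDiff_const_smul _),
      hχt.compact.comp_homeomorph (Homeomorph.smulOfNeZero (c n) (hc0 n).ne'), Set.subset_univ _⟩
  have hdψ : ∀ n i x, partialDeriv i (ψ n) x =
      c n * partialDeriv i (fun x => (χ x : ℂ)) (c n • x) := by
    intro n i x
    have h1 : HasFDerivAt (fun y : Euc d => c n • y) (c n • ContinuousLinearMap.id ℝ (Euc d)) x :=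
      (hasFDerivAt_id x).const_smul (c n)
    have h2 : HasFDerivAt (ψ n) _ x := (hχt.differentiable (c n • x)).hasFDerivAt.comp x h1
    rw [partialDeriv, h2.fderiv]
    simp [partialDeriv]
  have hψ1 : ∀ n x, ‖ψ n x‖ ≤ 1 := fun n x => by
    simp only [ψ, Complex.norm_real, Real.norm_of_nonneg χ.nonneg]
    exact χ.le_one
  have hψlim : ∀ x, Tendsto (fun n => ψ n x) atTop (𝓝 1) := by
    intro x
    have h1 : Tendsto (fun n => c n • x) atTop (𝓝 0) := by simpa using hclim.smul_const x
    have h2 := (hχt.smooth.continuous.tendsto 0).comp h1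
    have h3 : χ (0 : Euc d) = 1 := χ.one_of_mem_closedBall (Metric.mem_closedBall_self zero_le_one)
    simpa [h3, Function.comp_def] using h2
  have hb : ∀ i, ∃ C, ∀ n x, ‖partialDeriv i (ψ n) x‖ ≤ C * c n := by
    intro i
    obtain ⟨C, hC⟩ := (hχt.continuous_partialDeriv i).bounded_above_of_compact_support
      (hχt.hasCompactSupport_partialDeriv i)
    refine ⟨C, fun n x => ?_⟩
    rw [hdψ, norm_mul, Complex.norm_real, Real.norm_of_nonneg (hc0 n).le, mul_comm]
    exact mul_le_mul_of_nonneg_right (hC _) (hc0 n).le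
  have hlim : Tendsto (fun n => innerMul w w (ψ n)) atTop (𝓝 (inner ℂ w w)) := by
    rw [inner_eq, inner_toL2_eq, inner_L2Vec_eq]
    refine Tendsto.add ?_ (tendsto_finsetSum _ fun i _ => ?_)
    · refine tendsto_integral_of_dominated_convergence (fun x => ‖toL2 w x‖ ^ 2) (fun n => ?_)
        ((memLp_two_iff_integrable_sq_norm (Lp.memLp (toL2 w)).1).mp (Lp.memLp _))
        (fun n => Eventually.of_forall fun x => ?_) (Eventually.of_forall fun x => ?_)
      · exact (memLp_conj (Lp.memLp (toL2 w))).1.mul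
          ((hψ n).smooth.continuous.aestronglyMeasurable.mul (Lp.memLp (toL2 w)).1)
      · rw [norm_mul, norm_mul, RCLike.norm_conj]
        nlinarith [hψ1 n x, norm_nonneg (ψ n x), mul_self_nonneg ‖toL2 w x‖]
      · simpa using ((hψlim x).mul_const (toL2 w x)).const_mul (starRingEnd ℂ (toL2 w x))
    · obtain ⟨C, hC⟩ := hb i
      have hw2 := coord_memLp (grad w) i
      have hC0 : 0 ≤ C := by
        have := (norm_nonneg _).trans (hC 0 0)
        exact nonneg_of_mul_nonneg_left this (hc0 0)
      refine tendsto_integral_of_dominated_convergence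
        (fun x => C * (‖grad w x i‖ * ‖toL2 w x‖) + ‖grad w x i‖ ^ 2) (fun n => ?_)
        (((hw2.norm.integrable_mul (Lp.memLp (toL2 w)).norm).const_mul C).add
          ((memLp_two_iff_integrable_sq_norm hw2.1).mp hw2))
        (fun n => Eventually.of_forall fun x => ?_) (Eventually.of_forall fun x => ?_)
      · exact (memLp_conj hw2).1.mul
          ((((hψ n).continuous_partialDeriv i).aestronglyMeasurable.mul (Lp.memLp (toL2 w)).1).add
          ((hψ n).smooth.continuous.aestronglyMeasurable.mul hw2.1))
      · rw [norm_mul, RCLike.norm_conj]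
        calc ‖grad w x i‖ * ‖partialDeriv i (ψ n) x * toL2 w x + ψ n x * grad w x i‖
            ≤ ‖grad w x i‖ * (C * ‖toL2 w x‖ + 1 * ‖grad w x i‖) := by
              refine mul_le_mul_of_nonneg_left ((norm_add_le _ _).trans ?_) (norm_nonneg _)
              rw [norm_mul, norm_mul]
              have := (hC n x).trans (mul_le_of_le_one_right hC0 (hc1 n))
              gcongr
              exact hψ1 n x
          _ = _ := by ring
      · have h0 : Tendsto (fun n => partialDeriv i (ψ n) x) atTop (𝓝 0) :=
          squeeze_zero_norm (fun n => hC n x) (by simpa using hclim.const_mul C)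
        simpa using ((h0.mul_const (toL2 w x)).add ((hψlim x).mul_const (grad w x i))).const_mul
          (starRingEnd ℂ (grad w x i))
  have h0 := tendsto_nhds_unique hlim (tendsto_const_nhds.congr fun n => (hw _ (hψ n)).symm)
  exact inner_self_eq_zero.mp h0

theorem denseRange_testH1 {Ω : Set (Euc d)} (hΩ : IsOpen Ω) (hcone : HasLocalCone Ω) :
    DenseRange (testH1 Ω) := by
  have h : (LinearMap.range (testH1 Ω))ᗮ = ⊥ := by
    rw [eq_bot_iff]
    intro w hw
    rw [Submodule.mem_bot]
    refine eq_zero_of_innerMul_self fun ψ hψ => innerMul_eq_zero hΩ hcone (fun φ => ?_) w hψ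
    exact Submodule.inner_left_of_mem_orthogonal (LinearMap.mem_range_self _ φ) hw
  have h2 := (Submodule.topologicalClosure_eq_top_iff).mpr h
  have h3 := Submodule.dense_iff_topologicalClosure_eq_top.mpr h2
  rw [LinearMap.coe_range] at h3
  exact h3

/-! ### Geometry of Lipschitz domains -/

/-- The upward unit vector of the coordinate system `e`. -/
def upVec (e : Euc d ≃ₗᵢ[ℝ] WithLp 2 (Euc (d - 1) × ℝ)) : Euc d :=
  e.symm (WithLp.toLp 2 (0, 1))

theorem fst_map_add_smul_upVec (e : Euc d ≃ₗᵢ[ℝ] WithLp 2 (Euc (d - 1) × ℝ)) (y : Euc d)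
    (t : ℝ) : (e (y + t • upVec e)).fst = (e y).fst := by
  rw [map_add, map_smul, upVec, e.apply_symm_apply, WithLp.add_fst, WithLp.smul_fst]
  simp

theorem snd_map_add_smul_upVec (e : Euc d ≃ₗᵢ[ℝ] WithLp 2 (Euc (d - 1) × ℝ)) (y : Euc d)
    (t : ℝ) : (e (y + t • upVec e)).snd = (e y).snd + t := by
  rw [map_add, map_smul, upVec, e.apply_symm_apply, WithLp.add_snd, WithLp.smul_snd]
  simp

theorem continuous_fst_comp (e : Euc d ≃ₗᵢ[ℝ] WithLp 2 (Euc (d - 1) × ℝ)) :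
    Continuous fun y => (e y).fst := (WithLp.fstL 2 ℝ _ _).continuous.comp e.continuous

theorem continuous_snd_comp (e : Euc d ≃ₗᵢ[ℝ] WithLp 2 (Euc (d - 1) × ℝ)) :
    Continuous fun y => (e y).snd := (WithLp.sndL 2 ℝ _ _).continuous.comp e.continuous

theorem closure_epigraph (e : Euc d ≃ₗᵢ[ℝ] WithLp 2 (Euc (d - 1) × ℝ)) {φ : Euc (d - 1) → ℝ}
    (hφ : Continuous φ) :
    closure {y | φ (e y).fst < (e y).snd} = {y | φ (e y).fst ≤ (e y).snd} := by
  refine subset_antisymm (closure_lt_subset_le (hφ.comp (continuous_fst_comp e))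
    (continuous_snd_comp e)) fun y hy => ?_
  have h : Tendsto (fun t : ℝ => y + t • upVec e) (𝓝[>] 0) (𝓝 y) := by
    have : Tendsto (fun t : ℝ => y + t • upVec e) (𝓝 0) (𝓝 (y + (0 : ℝ) • upVec e)) :=
      (continuous_const.add (continuous_id.smul continuous_const)).tendsto 0
    rw [zero_smul, add_zero] at this
    exact this.mono_left nhdsWithin_le_nhds
  refine mem_closure_of_tendsto h (eventually_nhdsWithin_of_forall fun t ht => ?_)
  rw [Set.mem_Ioi] at ht
  rw [Set.mem_ofPred_eq] at hy ⊢
  rw [fst_map_add_smul_upVec, snd_map_add_smul_upVec]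
  linarith

theorem compl_closure_epigraph (e : Euc d ≃ₗᵢ[ℝ] WithLp 2 (Euc (d - 1) × ℝ))
    {φ : Euc (d - 1) → ℝ} (hφ : Continuous φ) :
    (closure {y | φ (e y).fst < (e y).snd})ᶜ = {y | (e y).snd < φ (e y).fst} := by
  rw [closure_epigraph e hφ]
  ext y
  simp

/-- Closure is a local notion; this transfers boundary and exterior of an epigraph to those of `Ω`
inside a chart. -/
theorem mem_closure_iff_of_inter_eq {U A B : Set (Euc d)} (hU : IsOpen U) (h : U ∩ A = U ∩ B)
    {x : Euc d} (hx : x ∈ U) : x ∈ closure A ↔ x ∈ closure B :=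
  ⟨fun hA => closure_mono Set.inter_subset_right (h ▸ hU.inter_closure ⟨hx, hA⟩),
    fun hB => closure_mono Set.inter_subset_right (h.symm ▸ hU.inter_closure ⟨hx, hB⟩)⟩

theorem eq_of_mem_frontier {U Ω : Set (Euc d)} (hU : IsOpen U) (hΩ : IsOpen Ω)
    {e : Euc d ≃ₗᵢ[ℝ] WithLp 2 (Euc (d - 1) × ℝ)} {φ : Euc (d - 1) → ℝ} (hφ : Continuous φ)
    (h : U ∩ Ω = U ∩ {y | φ (e y).fst < (e y).snd}) {x : Euc d} (hx : x ∈ U)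
    (hxf : x ∈ frontier Ω) : (e x).snd = φ (e x).fst := by
  rw [hΩ.frontier_eq] at hxf
  have h1 := (mem_closure_iff_of_inter_eq hU h hx).mp hxf.1
  rw [closure_epigraph e hφ] at h1
  refine le_antisymm ?_ h1
  by_contra! h2
  have : x ∈ U ∩ Ω := h ▸ ⟨hx, h2⟩
  exact hxf.2 this.2

/-- Reflecting all coordinates turns the region below the graph of `φ` into the region above the
graph of `x ↦ -φ (-x)`. -/
theorem IsSpecialLipschitz.compl_closure {M : ℝ≥0} {D : Set (Euc d)}
    (hD : IsSpecialLipschitz M D) : IsSpecialLipschitz M (closure D)ᶜ := by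
  obtain ⟨e, φ, hφ, rfl⟩ := hD
  refine ⟨e.trans (LinearIsometryEquiv.neg ℝ (E := WithLp 2 (Euc (d - 1) × ℝ))), fun x => -φ (-x), ?_, ?_⟩
  · have h : LipschitzWith M fun x : Euc (d - 1) => φ (-x) := by
      simpa using! hφ.comp (LinearIsometryEquiv.neg ℝ (E := Euc (d - 1))).lipschitz
    exact h.neg
  · rw [compl_closure_epigraph e hφ.continuous]
    ext y
    simp

/-! ### The exterior of a Lipschitz domain. -/

theorem IsLipschitzDomain.frontier_nonempty {Ω : Set (Euc d)} (hΩ : IsLipschitzDomain Ω)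
    (hne : Ω ≠ Set.univ) : (frontier Ω).Nonempty := by
  rw [nonempty_frontier_iff]
  exact ⟨hΩ.nonempty, hne⟩

/-- Moving down from a boundary point in its chart leaves the closure of `Ω` at once. Thus `Ω` never
lies on both sides of its boundary, which makes passage to the exterior an involution preserving the
boundary. -/
theorem IsLipschitzDomain.frontier_subset_closure_compl_closure {Ω : Set (Euc d)}
    (hΩ : IsLipschitzDomain Ω) : frontier Ω ⊆ closure (closure Ω)ᶜ := by
  intro x hx
  obtain ⟨ε, N, M, U, hε, hU, hc, -, hD⟩ := hΩ.exists_cover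
  obtain ⟨j, hj⟩ := hc x hx
  obtain ⟨D, ⟨e, φ, hφ, rfl⟩, hjD⟩ := hD j
  have hxU : x ∈ U j := hj (Metric.mem_ball_self hε)
  have heq := eq_of_mem_frontier (hU j) hΩ.isOpen hφ.continuous hjD hxU hx
  have h : Tendsto (fun t : ℝ => x + t • upVec e) (𝓝[<] 0) (𝓝 x) := by
    have : Tendsto (fun t : ℝ => x + t • upVec e) (𝓝 0) (𝓝 (x + (0 : ℝ) • upVec e)) :=
      (continuous_const.add (continuous_id.smul continuous_const)).tendsto 0
    rw [zero_smul, add_zero] at this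
    exact this.mono_left nhdsWithin_le_nhds
  refine mem_closure_of_tendsto h ?_
  filter_upwards [h.eventually_mem ((hU j).mem_nhds hxU), self_mem_nhdsWithin] with t ht1 ht2
  rw [Set.mem_compl_iff, mem_closure_iff_of_inter_eq (hU j) hjD ht1, closure_epigraph e
    hφ.continuous, Set.mem_ofPred_eq, fst_map_add_smul_upVec, snd_map_add_smul_upVec]
  rw [Set.mem_Iio] at ht2
  linarith

theorem IsLipschitzDomain.interior_closure {Ω : Set (Euc d)} (hΩ : IsLipschitzDomain Ω) :
    interior (closure Ω) = Ω := by
  refine subset_antisymm (fun x hx => ?_) hΩ.isOpen.subset_interior_closure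
  by_contra hxΩ
  have hxf : x ∈ frontier Ω := by
    rw [hΩ.isOpen.frontier_eq]
    exact ⟨interior_subset hx, hxΩ⟩
  have := hΩ.frontier_subset_closure_compl_closure hxf
  rw [closure_compl] at this
  exact this hx

theorem IsLipschitzDomain.compl_closure_compl_closure {Ω : Set (Euc d)}
    (hΩ : IsLipschitzDomain Ω) : (closure (closure Ω)ᶜ)ᶜ = Ω := by
  rw [closure_compl, compl_compl, hΩ.interior_closure]

theorem IsLipschitzDomain.frontier_compl_closure {Ω : Set (Euc d)} (hΩ : IsLipschitzDomain Ω) :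
    frontier (closure Ω)ᶜ = frontier Ω := by
  rw [frontier_compl, isClosed_closure.frontier_eq, hΩ.interior_closure, hΩ.isOpen.frontier_eq]

/-- The same cover with the same constants serves the exterior, since the two boundaries coincide.
-/
theorem IsLipschitzDomain.compl_closure {Ω : Set (Euc d)} (hΩ : IsLipschitzDomain Ω)
    (hne : Ω ≠ Set.univ) : IsLipschitzDomain (closure Ω)ᶜ := by
  refine ⟨isClosed_closure.isOpen_compl, ?_, ?_⟩
  · obtain ⟨x, hx⟩ := hΩ.frontier_nonempty hne
    exact closure_nonempty_iff.mp ⟨x, hΩ.frontier_subset_closure_compl_closure hx⟩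
  · obtain ⟨ε, N, M, U, hε, hU, hc, hN, hD⟩ := hΩ.exists_cover
    refine ⟨ε, N, M, U, hε, hU, fun x hx => hc x (hΩ.frontier_compl_closure ▸ hx), hN, fun j => ?_⟩
    obtain ⟨D, hDL, hjD⟩ := hD j
    refine ⟨(closure D)ᶜ, hDL.compl_closure, ?_⟩
    ext x
    simp only [Set.mem_inter_iff, Set.mem_compl_iff]
    exact and_congr_right fun hx => not_congr (mem_closure_iff_of_inter_eq (hU j) hjD hx)

theorem IsLipschitzDomain.compl_closure_ne_univ {Ω : Set (Euc d)} (hΩ : IsLipschitzDomain Ω) :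
    (closure Ω)ᶜ ≠ Set.univ := by
  obtain ⟨x, hx⟩ := hΩ.nonempty
  exact fun h => (h.symm ▸ Set.mem_univ x : x ∈ (closure Ω)ᶜ) (subset_closure hx)

theorem norm_fst_le (p : WithLp 2 (Euc (d - 1) × ℝ)) : ‖p.fst‖ ≤ ‖p‖ := by
  have := WithLp.prod_norm_sq_eq_of_L2 p
  exact (abs_le_of_sq_le_sq' (by nlinarith [sq_nonneg ‖p.snd‖]) (norm_nonneg _)).2

theorem norm_snd_le (p : WithLp 2 (Euc (d - 1) × ℝ)) : ‖p.snd‖ ≤ ‖p‖ := by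
  have := WithLp.prod_norm_sq_eq_of_L2 p
  exact (abs_le_of_sq_le_sq' (by nlinarith [sq_nonneg ‖p.fst‖]) (norm_nonneg _)).2

theorem IsLipschitzDomain.hasLocalCone {Ω : Set (Euc d)} (hΩ : IsLipschitzDomain Ω) :
    HasLocalCone Ω := by
  intro x₀
  by_cases h1 : x₀ ∈ Ω
  · obtain ⟨ρ, hρ, hsub⟩ := Metric.isOpen_iff.mp hΩ.isOpen x₀ h1
    exact ⟨ρ, 0, 1, hρ, one_pos, fun x _ _ s _ _ y hy _ => hsub hy⟩
  by_cases h2 : x₀ ∈ closure Ω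
  swap
  · obtain ⟨ρ, hρ, hsub⟩ := Metric.isOpen_iff.mp isClosed_closure.isOpen_compl x₀ h2
    exact ⟨ρ, 0, 1, hρ, one_pos, fun x hx hxb => absurd (subset_closure hx) (hsub hxb)⟩
  have hxf : x₀ ∈ frontier Ω := by
    rw [hΩ.isOpen.frontier_eq]
    exact ⟨h2, h1⟩
  obtain ⟨ε, N, M, U, hε, hU, hc, -, hD⟩ := hΩ.exists_cover
  obtain ⟨j, hj⟩ := hc x₀ hxf
  obtain ⟨D, ⟨e, φ, hφ, rfl⟩, hjD⟩ := hD j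
  have hM : 0 < 1 + (M : ℝ) := by positivity
  -- The aperture `1 / (1 + M)` balances the two effects: the rise is at least `s - s / (1 + M) = M
  -- s / (1 + M)`, which is also the largest possible increase of `φ` over a horizontal displacement
  -- of `s / (1 + M)`.
  refine ⟨ε, upVec e, 1 / (1 + M), hε, by positivity, fun x hx hxb s hs0 hs1 y hy hyx => ?_⟩
  have hxD : φ (e x).fst < (e x).snd := (hjD.subset ⟨hj hxb, hx⟩).2
  suffices hyD : φ (e y).fst < (e y).snd from
    (hjD.symm.subset ⟨hj hy, hyD⟩).2
  rw [Metric.mem_closedBall, dist_eq_norm, ← e.norm_map] at hyx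
  have hf := (norm_fst_le _).trans hyx
  have hs := (norm_snd_le _).trans hyx
  have he : e (y - x - s • upVec e) = e y - e (x + s • upVec e) := by
    rw [← map_sub]
    congr 1
    abel
  rw [he, WithLp.sub_fst, fst_map_add_smul_upVec] at hf
  rw [he, WithLp.sub_snd, snd_map_add_smul_upVec] at hs
  rw [Real.norm_eq_abs, abs_le] at hs
  have hl := hφ.dist_le_mul (e y).fst (e x).fst
  rw [dist_eq_norm, dist_eq_norm, Real.norm_eq_abs] at hl
  have hl2 := (le_abs_self _).trans (hl.trans (mul_le_mul_of_nonneg_left hf M.2))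
  have : (M : ℝ) * (s * (1 / (1 + M))) = s - s * (1 / (1 + M)) := by field_simp; ring
  have hl3 : φ (e y).fst - φ (e x).fst ≤ s - s * (1 / (1 + M)) := by
    rw [← this]; exact hl2
  linarith [hs.1]

theorem hasLocalCone_univ : HasLocalCone (Set.univ : Set (Euc d)) := fun _ =>
  ⟨1, 0, 1, one_pos, one_pos, fun _ _ _ _ _ _ _ _ _ => Set.mem_univ _⟩

/-! ### Surface measure on Lipschitz graphs -/

theorem _root_.LipschitzWith.euclideanHausdorffMeasure_image_le {X Y : Type*} [EMetricSpace X]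
    [MeasurableSpace X] [BorelSpace X] [EMetricSpace Y] [MeasurableSpace Y] [BorelSpace Y]
    {K : ℝ≥0} {f : X → Y} (hf : LipschitzWith K f) (m : ℕ) (s : Set X) :
    Measure.euclideanHausdorffMeasure m (f '' s) ≤
      (K : ℝ≥0∞) ^ m * Measure.euclideanHausdorffMeasure m s := by
  simp only [Measure.euclideanHausdorffMeasure_def, Measure.smul_apply, ENNReal.smul_def,
    smul_eq_mul]
  rw [mul_left_comm]
  gcongr
  simpa using hf.hausdorffMeasure_image_le (d := (m : ℝ)) (by positivity) s

/-- The parametrization of the graph of `φ` in the coordinate system `e`. -/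
def graphMap (e : Euc d ≃ₗᵢ[ℝ] WithLp 2 (Euc (d - 1) × ℝ)) (φ : Euc (d - 1) → ℝ)
    (x : Euc (d - 1)) : Euc d := e.symm (WithLp.toLp 2 (x, φ x))

theorem graphMap_fst {e : Euc d ≃ₗᵢ[ℝ] WithLp 2 (Euc (d - 1) × ℝ)} {φ : Euc (d - 1) → ℝ}
    {y : Euc d} (hy : (e y).snd = φ (e y).fst) : graphMap e φ (e y).fst = y := by
  rw [graphMap, ← hy]
  exact e.symm_apply_apply y

theorem fst_graphMap (e : Euc d ≃ₗᵢ[ℝ] WithLp 2 (Euc (d - 1) × ℝ)) (φ : Euc (d - 1) → ℝ)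
    (x : Euc (d - 1)) : (e (graphMap e φ x)).fst = x := by
  rw [graphMap, e.apply_symm_apply, WithLp.toLp_fst]

theorem snd_graphMap (e : Euc d ≃ₗᵢ[ℝ] WithLp 2 (Euc (d - 1) × ℝ)) (φ : Euc (d - 1) → ℝ)
    (x : Euc (d - 1)) : (e (graphMap e φ x)).snd = φ x := by
  rw [graphMap, e.apply_symm_apply, WithLp.toLp_snd]

theorem graphMap_add_smul_upVec (e : Euc d ≃ₗᵢ[ℝ] WithLp 2 (Euc (d - 1) × ℝ))
    (φ : Euc (d - 1) → ℝ) (x : Euc (d - 1)) (t : ℝ) :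
    graphMap e φ x + t • upVec e = e.symm (WithLp.toLp 2 (x, φ x + t)) := by
  rw [graphMap, upVec, ← map_smul, ← map_add, ← WithLp.toLp_smul, ← WithLp.toLp_add]
  simp

theorem lipschitzWith_graphMap (e : Euc d ≃ₗᵢ[ℝ] WithLp 2 (Euc (d - 1) × ℝ)) {M : ℝ≥0}
    {φ : Euc (d - 1) → ℝ} (hφ : LipschitzWith M φ) : LipschitzWith (1 + M) (graphMap e φ) := by
  refine LipschitzWith.of_dist_le_mul fun x y => ?_
  rw [graphMap, graphMap, e.symm.dist_map, dist_eq_norm, ← WithLp.toLp_sub]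
  have h1 := WithLp.prod_norm_sq_eq_of_L2 (WithLp.toLp 2 ((x, φ x) - (y, φ y)))
  have h2 := hφ.dist_le_mul x y
  simp only [Prod.mk_sub_mk, WithLp.toLp_fst, WithLp.toLp_snd] at h1
  rw [dist_eq_norm, dist_eq_norm] at h2
  rw [dist_eq_norm]
  have h3 : ‖WithLp.toLp 2 ((x, φ x) - (y, φ y))‖ ≤ ‖x - y‖ + ‖φ x - φ y‖ := by
    refine (abs_le_of_sq_le_sq' ?_ (by positivity)).2
    have := mul_nonneg (norm_nonneg (x - y)) (norm_nonneg (φ x - φ y))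
    rw [Prod.mk_sub_mk, h1]
    nlinarith
  refine h3.trans ?_
  push_cast
  linarith

/-- A Lipschitz map enlarges Hausdorff measure by at most a power of its constant; this upper bound
replaces the area formula. -/
theorem lintegral_graph_le (e : Euc d ≃ₗᵢ[ℝ] WithLp 2 (Euc (d - 1) × ℝ)) {M : ℝ≥0}
    {φ : Euc (d - 1) → ℝ} (hφ : LipschitzWith M φ) {Γ : Set (Euc d)}
    (hΓ : ∀ y ∈ Γ, (e y).snd = φ (e y).fst) {F : Euc d → ℝ≥0∞} (hF : Measurable F) :
    ∫⁻ y in Γ, F y ∂(Measure.euclideanHausdorffMeasure (d - 1)) ≤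
      ((1 + M : ℝ≥0) : ℝ≥0∞) ^ (d - 1) * ∫⁻ x in graphMap e φ ⁻¹' Γ, F (graphMap e φ x) := by
  have hg := lipschitzWith_graphMap e hφ
  have hgm : Measurable (graphMap e φ) := hg.continuous.measurable
  have hle : (Measure.euclideanHausdorffMeasure (d - 1)).restrict Γ ≤
      ((1 + M : ℝ≥0) : ℝ≥0∞) ^ (d - 1) •
        (volume.restrict (graphMap e φ ⁻¹' Γ)).map (graphMap e φ) := by
    refine Measure.le_iff.mpr fun B hB => ?_
    rw [Measure.restrict_apply hB, Measure.smul_apply, Measure.map_apply hgm hB,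
      Measure.restrict_apply (hgm hB), smul_eq_mul, ← Set.preimage_inter,
      ← EuclideanSpace.euclideanHausdorffMeasure_eq_volume]
    refine (measure_mono ?_).trans (hg.euclideanHausdorffMeasure_image_le _ _)
    intro y hy
    exact ⟨(e y).fst, by rwa [Set.mem_preimage, graphMap_fst (hΓ y hy.2)],
      graphMap_fst (hΓ y hy.2)⟩
  calc _ ≤ ∫⁻ y, F y ∂(((1 + M : ℝ≥0) : ℝ≥0∞) ^ (d - 1) •
        (volume.restrict (graphMap e φ ⁻¹' Γ)).map (graphMap e φ)) := lintegral_mono' hle le_rfl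
    _ = _ := by rw [lintegral_smul_measure, lintegral_map hF hgm, smul_eq_mul]

/-- Tonelli in the coordinates `e`, then a translation by `φ x` on each vertical line separately; no
regularity of `φ` enters. -/
theorem lintegral_eq_lintegral_graph (e : Euc d ≃ₗᵢ[ℝ] WithLp 2 (Euc (d - 1) × ℝ))
    {φ : Euc (d - 1) → ℝ} {W : Euc d → ℝ≥0∞} (hW : Measurable W) :
    ∫⁻ y, W y = ∫⁻ x, ∫⁻ t : ℝ, W (graphMap e φ x + t • upVec e) := by
  have h1 : MeasurePreserving (fun p : Euc (d - 1) × ℝ => e.symm (WithLp.toLp 2 p)) :=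
    e.symm.measurePreserving.comp (WithLp.volume_preserving_toLp _ _)
  rw [← h1.lintegral_comp hW, Measure.volume_eq_prod, lintegral_prod
    (fun p : Euc (d - 1) × ℝ => W (e.symm (WithLp.toLp 2 p)))
    (hW.comp h1.measurable).aemeasurable]
  congr 1
  ext x
  rw [← lintegral_add_left_eq_self _ (φ x)]
  simp only [graphMap_add_smul_upVec]

/-! ### The trace inequality for smooth functions. -/

theorem norm_upVec (e : Euc d ≃ₗᵢ[ℝ] WithLp 2 (Euc (d - 1) × ℝ)) : ‖upVec e‖ = 1 := by
  have h := WithLp.prod_norm_sq_eq_of_L2 (WithLp.toLp 2 ((0 : Euc (d - 1)), (1 : ℝ)))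
  rw [upVec, e.symm.norm_map]
  have : ‖WithLp.toLp 2 ((0 : Euc (d - 1)), (1 : ℝ))‖ ^ 2 = 1 := by rw [h]; simp
  exact (pow_eq_one_iff_of_nonneg (norm_nonneg _) two_ne_zero).mp this

theorem norm_fderiv_apply_le (v : Euc d → ℂ) (y w : Euc d) :
    ‖fderiv ℝ v y w‖ ≤ ‖gradFun v y‖ * ‖w‖ := by
  have hw : w = ∑ i, w i • EuclideanSpace.single i (1 : ℝ) := by
    ext j
    simp [Pi.single_apply]
  have : fderiv ℝ v y w = ∑ i, (w i : ℂ) * gradFun v y i := by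
    conv_lhs => rw [hw]
    rw [map_sum]
    refine Finset.sum_congr rfl fun i _ => ?_
    rw [map_smul, Complex.real_smul]
    rfl
  rw [this]
  refine (norm_sum_le _ _).trans ?_
  simp only [norm_mul, Complex.norm_real]
  rw [EuclideanSpace.norm_eq, EuclideanSpace.norm_eq, mul_comm]
  exact Real.sum_mul_le_sqrt_mul_sqrt _ _ _

/-- The density that controls boundary values. -/
def traceDensity (a b : ℝ) (v : Euc d → ℂ) (y : Euc d) : ℝ :=
  a * ‖v y‖ ^ 2 + b * ‖gradFun v y‖ ^ 2

theorem continuous_traceDensity (a b : ℝ) {v : Euc d → ℂ} (hv : IsTestFunction Set.univ v) :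
    Continuous (traceDensity a b v) :=
  (continuous_const.mul (hv.smooth.continuous.norm.pow 2)).add
    (continuous_const.mul (hv.continuous_gradFun.norm.pow 2))

/-- The fundamental theorem of calculus for `|v|²` along the segment, with `2 |v| |∇v| ≤ |v|² / δ +
δ |∇v|²`, averaged over the endpoint `t ∈ [0, h]`. The free parameter `δ` later makes the gradient
coefficient arbitrarily small. -/
theorem norm_sq_le_integral {v : Euc d → ℂ} (hv : IsTestFunction Set.univ v) (p : Euc d)
    {ν : Euc d} (hν : ‖ν‖ = 1) {h δ : ℝ} (hh : 0 < h) (hδ : 0 < δ) :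
    h * ‖v p‖ ^ 2 ≤ ∫ t : ℝ in (0 : ℝ)..h, traceDensity (1 + h / δ) (h * δ) v (p + t • ν) := by
  set g : ℝ → ℝ := fun t => ‖v (p + t • ν)‖ ^ 2 with hg
  set k : ℝ → ℝ := fun t => traceDensity (1 / δ) δ v (p + t • ν) with hk
  have hline : Continuous fun t : ℝ => p + t • ν := by fun_prop
  have hgc : Continuous g := (hv.smooth.continuous.comp hline).norm.pow 2
  have hkc : Continuous k := (continuous_traceDensity _ _ hv).comp hline
  have hd : ∀ t, HasDerivAt g (2 * inner ℝ (v (p + t • ν)) (fderiv ℝ v (p + t • ν) ν)) t := by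
    intro t
    have h1 : HasDerivAt (fun t : ℝ => p + t • ν) ν t := by
      simpa using ((hasDerivAt_id t).smul_const ν).const_add p
    exact ((hv.differentiable _).hasFDerivAt.comp_hasDerivAt t h1).norm_sq
  have hdc : Continuous fun t : ℝ =>
      2 * inner ℝ (v (p + t • ν)) (fderiv ℝ v (p + t • ν) ν) := by
    refine continuous_const.mul ((hv.smooth.continuous.comp hline).inner ?_)
    exact (((hv.smooth.continuous_fderiv (by simp)).comp hline).clm_apply continuous_const)
  have hdk : ∀ t, -(2 * inner ℝ (v (p + t • ν)) (fderiv ℝ v (p + t • ν) ν)) ≤ k t := by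
    intro t
    have h1 := (abs_le.mp (abs_real_inner_le_norm (v (p + t • ν)) (fderiv ℝ v (p + t • ν) ν))).1
    have h2 := norm_fderiv_apply_le v (p + t • ν) ν
    rw [hν, mul_one] at h2
    simp only [hk, traceDensity]
    set A := ‖v (p + t • ν)‖
    set B := ‖gradFun v (p + t • ν)‖
    have hA : 0 ≤ A := norm_nonneg _
    have h3 : A * ‖fderiv ℝ v (p + t • ν) ν‖ ≤ A * B := mul_le_mul_of_nonneg_left h2 hA
    have h4 : 2 * (A * B) ≤ 1 / δ * A ^ 2 + δ * B ^ 2 := by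
      have : 1 / δ * A ^ 2 + δ * B ^ 2 - 2 * (A * B) = (A - δ * B) ^ 2 / δ := by field_simp; ring
      have := div_nonneg (sq_nonneg (A - δ * B)) hδ.le
      linarith
    linarith
  have hk0 : ∀ t, 0 ≤ k t := fun t => by
    simp only [hk, traceDensity]; positivity
  have hpt : ∀ t ∈ Set.Icc 0 h, g 0 ≤ g t + ∫ τ in (0 : ℝ)..h, k τ := by
    intro t ht
    have h1 := intervalIntegral.integral_eq_sub_of_hasDerivAt (a := 0) (b := t)
      (fun x _ => hd x) (hdc.intervalIntegrable _ _)
    have h2 : -(∫ τ in (0 : ℝ)..t, 2 * inner ℝ (v (p + τ • ν)) (fderiv ℝ v (p + τ • ν) ν)) ≤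
        ∫ τ in (0 : ℝ)..t, k τ := by
      rw [← intervalIntegral.integral_neg]
      exact intervalIntegral.integral_mono_on ht.1 (hdc.neg.intervalIntegrable _ _)
        (hkc.intervalIntegrable _ _) fun x _ => hdk x
    have h3 : ∫ τ in (0 : ℝ)..t, k τ ≤ ∫ τ in (0 : ℝ)..h, k τ :=
      intervalIntegral.integral_mono_interval le_rfl ht.1 ht.2
        (Eventually.of_forall hk0) (hkc.intervalIntegrable _ _)
    linarith
  have h1 : ∫ _ in (0 : ℝ)..h, g 0 ≤ ∫ t in (0 : ℝ)..h, (g t + ∫ τ in (0 : ℝ)..h, k τ) :=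
    intervalIntegral.integral_mono_on hh.le intervalIntegrable_const
    ((hgc.add continuous_const).intervalIntegrable (μ := volume) 0 h) hpt
  rw [intervalIntegral.integral_const, intervalIntegral.integral_add
    (hgc.intervalIntegrable _ _) intervalIntegrable_const, intervalIntegral.integral_const,
    sub_zero, smul_eq_mul, smul_eq_mul, ← intervalIntegral.integral_const_mul,
    ← intervalIntegral.integral_add (hgc.intervalIntegrable _ _)
    ((hkc.intervalIntegrable _ _).const_mul h)] at h1
  have h0 : g 0 = ‖v p‖ ^ 2 := by simp [hg]
  rw [h0] at h1
  refine h1.trans (le_of_eq ?_)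
  congr 1
  ext t
  simp only [hg, hk, traceDensity]
  ring

theorem enorm_sq_le_lintegral {v : Euc d → ℂ} (hv : IsTestFunction Set.univ v) (p : Euc d)
    {ν : Euc d} (hν : ‖ν‖ = 1) {h δ : ℝ} (hh : 0 < h) (hδ : 0 < δ) :
    ‖v p‖ₑ ^ 2 ≤ ENNReal.ofReal h⁻¹ * ∫⁻ t : ℝ in Set.Ioc 0 h,
      ENNReal.ofReal (traceDensity (1 + h / δ) (h * δ) v (p + t • ν)) := by
  have h1 := norm_sq_le_integral hv p hν hh hδ
  have hc : Continuous fun t : ℝ => traceDensity (1 + h / δ) (h * δ) v (p + t • ν) :=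
    (continuous_traceDensity _ _ hv).comp (by fun_prop)
  rw [← ofReal_integral_eq_lintegral_ofReal
    ((intervalIntegrable_iff_integrableOn_Ioc_of_le hh.le).mp (hc.intervalIntegrable _ _))
    (Eventually.of_forall fun t => by simp only [traceDensity, Pi.zero_apply]; positivity),
    ← intervalIntegral.integral_of_le hh.le, ← ENNReal.ofReal_mul (by positivity),
    ← ofReal_norm, ← ENNReal.ofReal_pow (norm_nonneg _)]
  refine ENNReal.ofReal_le_ofReal ?_
  rw [inv_mul_eq_div, le_div_iff₀ hh, mul_comm]
  exact h1

theorem isClosed_setOf_ball_subset {U : Set (Euc d)} (ε : ℝ) :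
    IsClosed {p | Metric.ball p ε ⊆ U} := by
  have : {p | Metric.ball p ε ⊆ U} = (Metric.thickening ε Uᶜ)ᶜ := by
    ext p
    simp only [Set.mem_ofPred_eq, Set.mem_compl_iff, Metric.mem_thickening_iff, not_exists, not_and,
      Set.subset_def, Metric.mem_ball]
    exact forall_congr' fun y => by rw [dist_comm]; tauto
  rw [this]
  exact Metric.isOpen_thickening.isClosed_compl

theorem lintegral_chart_le {U Ω : Set (Euc d)} (hU : IsOpen U) (hΩ : IsOpen Ω)
    {e : Euc d ≃ₗᵢ[ℝ] WithLp 2 (Euc (d - 1) × ℝ)} {M : ℝ≥0} {φ : Euc (d - 1) → ℝ}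
    (hφ : LipschitzWith M φ) (hUΩ : U ∩ Ω = U ∩ {y | φ (e y).fst < (e y).snd})
    {v : Euc d → ℂ} (hv : IsTestFunction Set.univ v) {ε δ : ℝ} (hε : 0 < ε) (hδ : 0 < δ) :
    ∫⁻ y in {p | p ∈ frontier Ω ∧ Metric.ball p ε ⊆ U}, ‖v y‖ₑ ^ 2
      ∂(Measure.euclideanHausdorffMeasure (d - 1)) ≤
      ((1 + M : ℝ≥0) : ℝ≥0∞) ^ (d - 1) * (ENNReal.ofReal (ε / 2)⁻¹ * ∫⁻ y in U ∩ Ω,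
        ENNReal.ofReal (traceDensity (1 + ε / 2 / δ) (ε / 2 * δ) v y)) := by
  -- Segments of height `ε / 2` above a point of `Γ` stay in its `ε`-ball, hence in `U`, where `Ω`
  -- is the epigraph.
  have hε2 : 0 < ε / 2 := half_pos hε
  set Γ := {p | p ∈ frontier Ω ∧ Metric.ball p ε ⊆ U} with hΓ
  have hΓg : ∀ y ∈ Γ, (e y).snd = φ (e y).fst := fun y hy =>
    eq_of_mem_frontier hU hΩ hφ.continuous hUΩ (hy.2 (Metric.mem_ball_self hε)) hy.1
  have hΓm : MeasurableSet Γ := (isClosed_frontier.inter (isClosed_setOf_ball_subset ε)).measurableSet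
  have hgm : Measurable (graphMap e φ) := (lipschitzWith_graphMap e hφ).continuous.measurable
  set W : Euc d → ℝ≥0∞ := fun y =>
    ENNReal.ofReal (traceDensity (1 + ε / 2 / δ) (ε / 2 * δ) v y) with hW
  have hWm : Measurable W :=
    (continuous_traceDensity _ _ hv).measurable.ennreal_ofReal
  have hUm : MeasurableSet (U ∩ Ω) := (hU.inter hΩ).measurableSet
  refine (lintegral_graph_le e hφ hΓg (hv.smooth.continuous.enorm.measurable.pow_const 2)).trans ?_
  gcongr
  rw [← lintegral_indicator hUm, lintegral_eq_lintegral_graph e (φ := φ) (hWm.indicator hUm),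
    ← lintegral_const_mul' _ _ ENNReal.ofReal_ne_top]
  refine (setLIntegral_mono_ae' (hgm hΓm) (g := fun x => ENNReal.ofReal (ε / 2)⁻¹ *
    ∫⁻ t : ℝ, (U ∩ Ω).indicator W (graphMap e φ x + t • upVec e)) ?_).trans (setLIntegral_le_lintegral _ _)
  refine Eventually.of_forall fun x hx => ?_
  refine (enorm_sq_le_lintegral hv (graphMap e φ x) (norm_upVec e) hε2 hδ).trans ?_
  refine mul_le_mul' le_rfl ?_
  rw [← lintegral_indicator measurableSet_Ioc]
  refine lintegral_mono fun t => ?_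
  by_cases ht : t ∈ Set.Ioc 0 (ε / 2)
  · have hmem : graphMap e φ x + t • upVec e ∈ U ∩ Ω := by
      have hU' : graphMap e φ x + t • upVec e ∈ U := by
        refine hx.2 ?_
        rw [Metric.mem_ball, dist_eq_norm, add_sub_cancel_left, norm_smul, norm_upVec,
          Real.norm_of_nonneg ht.1.le]
        linarith [ht.2]
      rw [hUΩ]
      refine ⟨hU', ?_⟩
      rw [Set.mem_ofPred_eq, fst_map_add_smul_upVec, snd_map_add_smul_upVec, fst_graphMap,
        snd_graphMap]
      linarith [ht.1]
    rw [Set.indicator_of_mem ht, Set.indicator_of_mem hmem]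
  · rw [Set.indicator_of_notMem ht]
    exact zero_le

/-- At each point at most `N` terms of the summed integrand are nonzero. -/
theorem tsum_setLIntegral_le {U : ℕ → Set (Euc d)} (hU : ∀ j, IsOpen (U j)) {N : ℕ}
    (hN : ∀ x, {j | x ∈ U j}.encard ≤ N) (Ω : Set (Euc d)) {W : Euc d → ℝ≥0∞}
    (hW : Measurable W) : ∑' j, ∫⁻ y in U j ∩ Ω, W y ≤ N * ∫⁻ y in Ω, W y := by
  have h1 : ∀ j, ∫⁻ y in U j ∩ Ω, W y = ∫⁻ y in Ω, (U j).indicator W y := fun j => by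
    rw [lintegral_indicator (hU j).measurableSet, Measure.restrict_restrict (hU j).measurableSet]
  simp only [h1]
  rw [← lintegral_tsum fun j => (hW.indicator (hU j).measurableSet).aemeasurable,
    ← lintegral_const_mul' _ _ (ENNReal.natCast_ne_top N)]
  refine lintegral_mono fun y => ?_
  have h2 : ∀ j, (U j).indicator W y = {j | y ∈ U j}.indicator (fun _ => W y) j := fun j => by
    simp only [Set.indicator, Set.mem_ofPred_eq]
  simp only [h2]
  rw [← tsum_subtype, ENNReal.tsum_set_const]
  gcongr
  exact_mod_cast ENat.toENNReal_le.mpr (hN y)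

/-- The chart estimates are summed using bounded overlap. The essential point is that `C` and `h` do
not depend on `δ`. -/
theorem IsLipschitzDomain.lintegral_trace_le {Ω : Set (Euc d)} (hΩ : IsLipschitzDomain Ω) :
    ∃ C h : ℝ, 0 ≤ C ∧ 0 < h ∧ ∀ δ : ℝ, 0 < δ → ∀ v : Euc d → ℂ, IsTestFunction Set.univ v →
      ∫⁻ y, ‖v y‖ₑ ^ 2 ∂(surfaceMeasure Ω) ≤ ENNReal.ofReal C * ∫⁻ y in Ω,
        ENNReal.ofReal (traceDensity (1 + h / δ) (h * δ) v y) := by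
  obtain ⟨ε, N, M, U, hε, hU, hc, hN, hD⟩ := hΩ.exists_cover
  have hε2 : 0 < ε / 2 := half_pos hε
  refine ⟨(1 + M) ^ (d - 1) * ((ε / 2)⁻¹ * N), ε / 2, by positivity, hε2, fun δ hδ v hv => ?_⟩
  have hWm : Measurable fun y => ENNReal.ofReal (traceDensity (1 + ε / 2 / δ) (ε / 2 * δ) v y) :=
    (continuous_traceDensity _ _ hv).measurable.ennreal_ofReal
  have hcov : frontier Ω ⊆ ⋃ j, {p | p ∈ frontier Ω ∧ Metric.ball p ε ⊆ U j} := fun x hx => by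
    obtain ⟨j, hj⟩ := hc x hx
    exact Set.mem_iUnion.mpr ⟨j, hx, hj⟩
  calc ∫⁻ y, ‖v y‖ₑ ^ 2 ∂(surfaceMeasure Ω)
      ≤ ∑' j, ∫⁻ y in {p | p ∈ frontier Ω ∧ Metric.ball p ε ⊆ U j}, ‖v y‖ₑ ^ 2
          ∂(Measure.euclideanHausdorffMeasure (d - 1)) :=
        (lintegral_mono_set hcov).trans (lintegral_iUnion_le _ _)
    _ ≤ ∑' j, ((1 + M : ℝ≥0) : ℝ≥0∞) ^ (d - 1) * (ENNReal.ofReal (ε / 2)⁻¹ * ∫⁻ y in U j ∩ Ω,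
        ENNReal.ofReal (traceDensity (1 + ε / 2 / δ) (ε / 2 * δ) v y)) := by
        refine ENNReal.tsum_le_tsum fun j => ?_
        obtain ⟨D, ⟨e, φ, hφ, rfl⟩, hjD⟩ := hD j
        exact lintegral_chart_le (hU j) hΩ.isOpen hφ hjD hv hε hδ
    _ ≤ ((1 + M : ℝ≥0) : ℝ≥0∞) ^ (d - 1) * (ENNReal.ofReal (ε / 2)⁻¹ * (N * ∫⁻ y in Ω,
        ENNReal.ofReal (traceDensity (1 + ε / 2 / δ) (ε / 2 * δ) v y))) := by
        rw [ENNReal.tsum_mul_left, ENNReal.tsum_mul_left]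
        gcongr
        exact tsum_setLIntegral_le hU hN Ω hWm
    _ = _ := by
        rw [ENNReal.ofReal_mul (by positivity), ENNReal.ofReal_mul (by positivity),
          ENNReal.ofReal_pow (by positivity), ENNReal.ofReal_natCast, mul_assoc, mul_assoc]
        congr 2
        rw [← ENNReal.ofReal_coe_nnreal]
        push_cast
        rfl

/-- The projection to the base hyperplane of a chart is `1`-Lipschitz, and the image of `∂Ω`
contains a nonempty open set, which has positive Lebesgue measure. -/
theorem IsLipschitzDomain.surfaceMeasure_ne_zero {Ω : Set (Euc d)} (hΩ : IsLipschitzDomain Ω)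
    (hne : Ω ≠ Set.univ) : surfaceMeasure Ω ≠ 0 := by
  obtain ⟨x₀, hx₀⟩ := hΩ.frontier_nonempty hne
  obtain ⟨ε, N, M, U, hε, hU, hc, -, hD⟩ := hΩ.exists_cover
  obtain ⟨j, hj⟩ := hc x₀ hx₀
  obtain ⟨D, ⟨e, φ, hφ, rfl⟩, hjD⟩ := hD j
  have hxU : x₀ ∈ U j := hj (Metric.mem_ball_self hε)
  have hx0 := eq_of_mem_frontier (hU j) hΩ.isOpen hφ.continuous hjD hxU hx₀
  have hgc := (lipschitzWith_graphMap e hφ).continuous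
  set A := graphMap e φ ⁻¹' U j with hA
  have hAo : IsOpen A := (hU j).preimage hgc
  have hAne : A.Nonempty := ⟨(e x₀).fst, by rwa [hA, Set.mem_preimage, graphMap_fst hx0]⟩
  have hsub : A ⊆ (fun y => (e y).fst) '' frontier Ω := by
    intro x hx
    refine ⟨graphMap e φ x, ?_, fst_graphMap e φ x⟩
    rw [hΩ.isOpen.frontier_eq]
    refine ⟨(mem_closure_iff_of_inter_eq (hU j) hjD hx).mpr ?_, fun h => ?_⟩
    · rw [closure_epigraph e hφ.continuous, Set.mem_ofPred_eq, fst_graphMap, snd_graphMap]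
    · have := (hjD.subset ⟨hx, h⟩).2
      rw [Set.mem_ofPred_eq, fst_graphMap, snd_graphMap] at this
      exact lt_irrefl _ this
  have hlip : LipschitzWith 1 fun y : Euc d => (e y).fst := by
    refine LipschitzWith.of_dist_le_mul fun x y => ?_
    rw [NNReal.coe_one, one_mul, dist_eq_norm, dist_eq_norm, ← WithLp.sub_fst, ← map_sub,
      ← e.norm_map (x - y)]
    exact norm_fst_le _
  intro h0
  have h1 : Measure.euclideanHausdorffMeasure (d - 1) (frontier Ω) = 0 := by
    rw [← Measure.restrict_apply_self]
    change surfaceMeasure Ω _ = 0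
    rw [h0]
    simp
  have h2 := (measure_mono hsub).trans (hlip.euclideanHausdorffMeasure_image_le (d - 1) _)
  rw [h1, mul_zero, EuclideanSpace.euclideanHausdorffMeasure_eq_volume] at h2
  exact (hAo.measure_pos volume hAne).ne' (le_antisymm h2 (zero_le))

/-! ### The trace operator -/

theorem lintegral_enorm_sq_eq {F : Type*} [NormedAddCommGroup F] {μ : Measure (Euc d)}
    (f : Lp F 2 μ) : ∫⁻ x, ‖f x‖ₑ ^ 2 ∂μ = ENNReal.ofReal (‖f‖ ^ 2) := by
  rw [norm_sq_eq_lintegral, ENNReal.ofReal_toReal (lintegral_enorm_sq_ne_top (Lp.memLp f))]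

theorem lintegral_traceDensity (Ω : Set (Euc d)) {a b : ℝ} (ha : 0 ≤ a) (hb : 0 ≤ b)
    (v : testSpace d) : ∫⁻ y in Ω, ENNReal.ofReal (traceDensity a b v y) =
      ENNReal.ofReal (a * ‖toL2 (testH1 Ω v)‖ ^ 2 + b * ‖grad (testH1 Ω v)‖ ^ 2) := by
  have hv := isTestFunction_coe v
  rw [ENNReal.ofReal_add (by positivity) (by positivity), ENNReal.ofReal_mul ha,
    ENNReal.ofReal_mul hb, ← lintegral_enorm_sq_eq, ← lintegral_enorm_sq_eq,
    ← lintegral_const_mul' _ _ ENNReal.ofReal_ne_top,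
    ← lintegral_const_mul' _ _ ENNReal.ofReal_ne_top]
  have h1 : ∫⁻ x in Ω, ENNReal.ofReal a * ‖toL2 (testH1 Ω v) x‖ₑ ^ 2 =
      ∫⁻ x in Ω, ENNReal.ofReal a * ‖(v : Euc d → ℂ) x‖ₑ ^ 2 := by
    refine lintegral_congr_ae ?_
    filter_upwards [toL2_testH1 (Ω := Ω) v] with x hx
    rw [hx]
  have h2 : ∫⁻ x in Ω, ENNReal.ofReal b * ‖grad (testH1 Ω v) x‖ₑ ^ 2 =
      ∫⁻ x in Ω, ENNReal.ofReal b * ‖gradFun v x‖ₑ ^ 2 := by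
    refine lintegral_congr_ae ?_
    filter_upwards [grad_testH1 (Ω := Ω) v] with x hx
    rw [hx]
  rw [h1, h2, ← lintegral_add_left
    ((hv.smooth.continuous.enorm.measurable.pow_const 2).const_mul _)]
  congr 1
  ext x
  rw [traceDensity, ENNReal.ofReal_add (by positivity) (by positivity), ENNReal.ofReal_mul ha,
    ENNReal.ofReal_mul hb, ENNReal.ofReal_pow (norm_nonneg _), ENNReal.ofReal_pow (norm_nonneg _),
    ofReal_norm, ofReal_norm]

theorem IsLipschitzDomain.lintegral_trace_le' {Ω : Set (Euc d)} (hΩ : IsLipschitzDomain Ω)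
    {ε : ℝ} (hε : 0 < ε) : ∃ C : ℝ, 0 ≤ C ∧ ∀ v : testSpace d,
      ∫⁻ y, ‖(v : Euc d → ℂ) y‖ₑ ^ 2 ∂(surfaceMeasure Ω) ≤
        ENNReal.ofReal (ε * ‖grad (testH1 Ω v)‖ ^ 2 + C * ‖toL2 (testH1 Ω v)‖ ^ 2) := by
  obtain ⟨C, h, hC, hh, H⟩ := hΩ.lintegral_trace_le
  -- Chosen so that the gradient coefficient `C * (h * δ)` is at most `ε`; the summand `1` covers
  -- the case `C = 0`.
  set δ : ℝ := ε / (C * h + 1) with hδ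
  have hδ0 : 0 < δ := by positivity
  refine ⟨C * (1 + h / δ), by positivity, fun v => ?_⟩
  refine (H δ hδ0 v (isTestFunction_coe v)).trans ?_
  rw [lintegral_traceDensity Ω (by positivity) (by positivity), ← ENNReal.ofReal_mul hC]
  refine ENNReal.ofReal_le_ofReal ?_
  have h1 : C * (h * δ) ≤ ε := by
    have : C * (h * δ) = ε * ((C * h) / (C * h + 1)) := by rw [hδ]; ring
    rw [this]
    refine mul_le_of_le_one_right hε.le (div_le_one_of_le₀ (by linarith) (by positivity))
  have h2 := mul_le_mul_of_nonneg_right h1 (sq_nonneg ‖grad (testH1 Ω v)‖)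
  linarith

theorem IsLipschitzDomain.memLp_surfaceMeasure {Ω : Set (Euc d)} (hΩ : IsLipschitzDomain Ω)
    (v : testSpace d) : MemLp (v : Euc d → ℂ) 2 (surfaceMeasure Ω) := by
  refine ⟨(isTestFunction_coe v).smooth.continuous.aestronglyMeasurable, ?_⟩
  obtain ⟨C, -, H⟩ := hΩ.lintegral_trace_le' one_pos
  rw [eLpNorm_lt_top_iff_lintegral_rpow_enorm_lt_top (by norm_num) (by norm_num)]
  have := (H v).trans_lt ENNReal.ofReal_lt_top
  simpa using this

/-- Restriction of functions in `C_c^∞(ℝ^d)` to the boundary. -/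
def IsLipschitzDomain.traceTest {Ω : Set (Euc d)} (hΩ : IsLipschitzDomain Ω) :
    testSpace d →ₗ[ℂ] L2Boundary Ω where
  toFun v := (hΩ.memLp_surfaceMeasure v).toLp _
  map_add' _ _ := rfl
  map_smul' _ _ := rfl

theorem IsLipschitzDomain.norm_traceTest_sq {Ω : Set (Euc d)} (hΩ : IsLipschitzDomain Ω)
    (v : testSpace d) : ENNReal.ofReal (‖hΩ.traceTest v‖ ^ 2) =
      ∫⁻ y, ‖(v : Euc d → ℂ) y‖ₑ ^ 2 ∂(surfaceMeasure Ω) := by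
  rw [← lintegral_enorm_sq_eq]
  refine lintegral_congr_ae ?_
  filter_upwards [(hΩ.memLp_surfaceMeasure v).coeFn_toLp] with x hx
  rw [← hx]
  rfl

theorem IsLipschitzDomain.norm_traceTest_sq_le {Ω : Set (Euc d)} (hΩ : IsLipschitzDomain Ω)
    {ε : ℝ} (hε : 0 < ε) : ∃ C : ℝ, 0 ≤ C ∧ ∀ v : testSpace d,
      ‖hΩ.traceTest v‖ ^ 2 ≤ ε * ‖grad (testH1 Ω v)‖ ^ 2 + C * ‖toL2 (testH1 Ω v)‖ ^ 2 := by
  obtain ⟨C, hC, H⟩ := hΩ.lintegral_trace_le' hε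
  refine ⟨C, hC, fun v => ?_⟩
  have := H v
  rwa [← hΩ.norm_traceTest_sq, ENNReal.ofReal_le_ofReal_iff (by positivity)] at this

theorem IsLipschitzDomain.denseRange_testH1 {Ω : Set (Euc d)} (hΩ : IsLipschitzDomain Ω) :
    DenseRange (testH1 Ω) := RobinExtension.denseRange_testH1 hΩ.isOpen hΩ.hasLocalCone

theorem eq_testH1 {Ω : Set (Euc d)} (hΩ : IsOpen Ω) {φ : Euc d → ℂ}
    (hφ : IsTestFunction Set.univ φ) {u : H1 Ω} (hu : toL2 u =ᵐ[volume.restrict Ω] φ) :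
    u = testH1 Ω ⟨φ, hφ⟩ :=
  toL2_injective hΩ (Lp.ext (hu.trans (toL2_testH1 (Ω := Ω) ⟨φ, hφ⟩).symm))

theorem IsLipschitzDomain.exists_isTraceOperator {Ω : Set (Euc d)} (hΩ : IsLipschitzDomain Ω) :
    ∃ T : H1 Ω →L[ℂ] L2Boundary Ω, IsTraceOperator T := by
  obtain ⟨C, hC, H⟩ := hΩ.norm_traceTest_sq_le one_pos
  have hb : ∃ K : ℝ, ∀ v, ‖hΩ.traceTest v‖ ≤ K * ‖testH1 Ω v‖ := by
    -- The square of `1 + C` dominates both coefficients `1` and `C`.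
    refine ⟨1 + C, fun v => (abs_le_of_sq_le_sq' ?_ (by positivity)).2⟩
    refine (H v).trans ?_
    rw [mul_pow, norm_sq_eq]
    have h1 := sq_nonneg ‖grad (testH1 Ω v)‖
    have h2 := sq_nonneg ‖toL2 (testH1 Ω v)‖
    nlinarith [mul_nonneg hC h1, mul_nonneg hC h2, mul_nonneg (mul_nonneg hC hC) h1,
      mul_nonneg (mul_nonneg hC hC) h2]
  refine ⟨hΩ.traceTest.extendOfNorm (testH1 Ω), fun φ hφ u hu => ?_⟩
  rw [eq_testH1 hΩ.isOpen hφ hu, LinearMap.extendOfNorm_eq hΩ.denseRange_testH1 hb]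
  exact (hΩ.memLp_surfaceMeasure ⟨φ, hφ⟩).coeFn_toLp

theorem IsLipschitzDomain.isTraceOperator_trace {Ω : Set (Euc d)} (hΩ : IsLipschitzDomain Ω) :
    IsTraceOperator (trace Ω) := by
  rw [trace, dif_pos hΩ.exists_isTraceOperator]
  exact hΩ.exists_isTraceOperator.choose_spec

theorem IsLipschitzDomain.trace_testH1 {Ω : Set (Euc d)} (hΩ : IsLipschitzDomain Ω)
    (v : testSpace d) : trace Ω (testH1 Ω v) = hΩ.traceTest v :=
  Lp.ext ((hΩ.isTraceOperator_trace v (isTestFunction_coe v) _ (toL2_testH1 v)).trans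
    (hΩ.memLp_surfaceMeasure v).coeFn_toLp.symm)

/-- The form domain inequality: boundary terms are infinitesimally small with respect to the
gradient. -/
def HasTraceBound (Ω : Set (Euc d)) : Prop :=
  ∀ ε : ℝ, 0 < ε → ∃ C : ℝ, 0 ≤ C ∧ ∀ u : H1 Ω,
    ‖trace Ω u‖ ^ 2 ≤ ε * ‖grad u‖ ^ 2 + C * ‖toL2 u‖ ^ 2

theorem IsLipschitzDomain.hasTraceBound {Ω : Set (Euc d)} (hΩ : IsLipschitzDomain Ω) :
    HasTraceBound Ω := by
  intro ε hε
  obtain ⟨C, hC, H⟩ := hΩ.norm_traceTest_sq_le hε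
  refine ⟨C, hC, fun u => ?_⟩
  refine hΩ.denseRange_testH1.induction_on
    (p := fun u => ‖trace Ω u‖ ^ 2 ≤ ε * ‖grad u‖ ^ 2 + C * ‖toL2 u‖ ^ 2) u ?_ fun v => ?_
  · refine isClosed_le ((trace Ω).continuous.norm.pow 2) (Continuous.add ?_ ?_)
    · exact continuous_const.mul ((gradCLM Ω).continuous.norm.pow 2)
    · exact continuous_const.mul ((toL2CLM Ω).continuous.norm.pow 2)
  · rw [hΩ.trace_testH1]
    exact H v

/-- For test functions both traces are the same restriction to the common boundary, and density in
`H¹(ℝ^d)` extends this. Norms are compared because the two traces lie in formally different `L²`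
spaces. -/
theorem IsLipschitzDomain.norm_trace_restr {Ω : Set (Euc d)} (hΩ : IsLipschitzDomain Ω)
    (hne : Ω ≠ Set.univ) (u : H1 (Set.univ : Set (Euc d))) :
    ‖trace (closure Ω)ᶜ (restr (closure Ω)ᶜ u)‖ = ‖trace Ω (restr Ω u)‖ := by
  have hΩ' := hΩ.compl_closure hne
  have hdense : DenseRange (testH1 (Set.univ : Set (Euc d))) :=
    RobinExtension.denseRange_testH1 isOpen_univ hasLocalCone_univ
  refine hdense.induction_on (p := fun u =>
    ‖trace (closure Ω)ᶜ (restr (closure Ω)ᶜ u)‖ = ‖trace Ω (restr Ω u)‖) u ?_ fun v => ?_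
  · exact isClosed_eq ((trace _).continuous.comp (continuous_restr _)).norm
      ((trace _).continuous.comp (continuous_restr _)).norm
  · rw [restr_testH1, restr_testH1, hΩ.trace_testH1, hΩ'.trace_testH1]
    have h1 := hΩ.norm_traceTest_sq v
    have h2 := hΩ'.norm_traceTest_sq v
    have hs : surfaceMeasure (closure Ω)ᶜ = surfaceMeasure Ω := by
      rw [surfaceMeasure, surfaceMeasure, hΩ.frontier_compl_closure]
    have h3 : ∫⁻ y, ‖(v : Euc d → ℂ) y‖ₑ ^ 2 ∂(surfaceMeasure (closure Ω)ᶜ) =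
        ∫⁻ y, ‖(v : Euc d → ℂ) y‖ₑ ^ 2 ∂(surfaceMeasure Ω) := by rw [hs]
    rw [h3, ← h1, ENNReal.ofReal_eq_ofReal_iff (by positivity) (by positivity)] at h2
    exact (pow_left_inj₀ (norm_nonneg _) (norm_nonneg _) two_ne_zero).mp h2

/-- If the trace vanished, bump functions equal to `1` on large balls would show that every ball is
null for the surface measure. -/
theorem IsLipschitzDomain.norm_trace_pos {Ω : Set (Euc d)} (hΩ : IsLipschitzDomain Ω)
    (hne : Ω ≠ Set.univ) : 0 < ‖trace Ω‖ := by
  refine (ContinuousLinearMap.opNorm_nonneg _).lt_of_ne fun hn => ?_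
  have h0 : ∀ u, trace Ω u = 0 := fun u =>
    norm_le_zero_iff.mp (((trace Ω).le_opNorm u).trans (by rw [← hn, zero_mul]))
  refine hΩ.surfaceMeasure_ne_zero hne ?_
  rw [← Measure.measure_univ_eq_zero, ← Metric.iUnion_closedBall_nat (0 : Euc d),
    measure_iUnion_null_iff]
  intro n
  let χ : ContDiffBump (0 : Euc d) := ⟨n + 1, n + 2, by positivity, by linarith⟩
  have hχ : IsTestFunction Set.univ fun x => (χ x : ℂ) :=
    IsTestFunction.ofReal χ.contDiff χ.hasCompactSupport (Set.subset_univ _)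
  have h1 := hΩ.norm_traceTest_sq ⟨_, hχ⟩
  rw [← hΩ.trace_testH1, h0] at h1
  have h2 : ∫⁻ y, ‖(χ y : ℂ)‖ₑ ^ 2 ∂(surfaceMeasure Ω) = 0 := by
    rw [← h1]
    simp
  refine le_antisymm ?_ zero_le
  rw [← h2]
  calc surfaceMeasure Ω (Metric.closedBall 0 n)
      = ∫⁻ y in Metric.closedBall 0 n, 1 ∂(surfaceMeasure Ω) := by simp
    _ ≤ ∫⁻ y in Metric.closedBall 0 n, ‖(χ y : ℂ)‖ₑ ^ 2 ∂(surfaceMeasure Ω) := by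
        refine setLIntegral_mono' Metric.isClosed_closedBall.measurableSet fun y hy => ?_
        have : χ y = 1 := χ.one_of_mem_closedBall
          (Metric.closedBall_subset_closedBall (by linarith) hy)
        simp [this]
    _ ≤ _ := setLIntegral_le_lintegral _ _

/-! ### The bottom of the spectrum of the Robin Laplacian -/

/-- The quadratic form `t_β[u, u]`. -/
def robinQuad (Ω : Set (Euc d)) (β : ℝ) (u : H1 Ω) : ℝ :=
  ‖grad u‖ ^ 2 - β * ‖trace Ω u‖ ^ 2

/-- The bounded operator on `H¹(Ω)` that represents the form `t_β - t`. -/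
def formOp (Ω : Set (Euc d)) (β t : ℝ) : H1 Ω →L[ℂ] H1 Ω :=
  (gradCLM Ω).adjoint ∘L gradCLM Ω - (β : ℂ) • ((trace Ω).adjoint ∘L trace Ω) -
    (t : ℂ) • ((toL2CLM Ω).adjoint ∘L toL2CLM Ω)

theorem inner_formOp {Ω : Set (Euc d)} (β t : ℝ) (f g : H1 Ω) :
    inner ℂ g (formOp Ω β t f) = robinForm Ω β f g - t * inner ℂ (toL2 g) (toL2 f) := by
  simp [formOp, robinForm, ContinuousLinearMap.adjoint_inner_right]

theorem inner_formOp_self {Ω : Set (Euc d)} (β t : ℝ) (u : H1 Ω) :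
    inner ℂ u (formOp Ω β t u) = ((robinQuad Ω β u - t * ‖toL2 u‖ ^ 2 : ℝ) : ℂ) := by
  rw [inner_formOp, robinForm, inner_self_eq_norm_sq_to_K, inner_self_eq_norm_sq_to_K,
    inner_self_eq_norm_sq_to_K, robinQuad]
  push_cast
  rfl

/-- `toLinearPMap` returns the prescribed graph only if it is single-valued, which follows from
`toL2_injective` and density of `H¹(Ω)` in `L²(Ω)`. -/
theorem mem_robinLaplacian_graph {Ω : Set (Euc d)} (hΩ : IsOpen Ω) {β : ℝ} {p : L2 Ω × L2 Ω} :
    p ∈ (robinLaplacian Ω β).graph ↔ ∃ f : H1 Ω, toL2 f = p.1 ∧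
      ∀ g : H1 Ω, robinForm Ω β f g = inner ℂ (toL2 g) p.2 := by
  rw [robinLaplacian, Submodule.toLinearPMap_graph_eq]
  · rfl
  · rintro x ⟨f, hf, hfg⟩ hx
    rw [hx] at hf
    have hf0 : f = 0 := toL2_injective hΩ (by rw [hf, map_zero])
    refine eq_zero_of_forall_inner_toL2 hΩ fun u => ?_
    rw [← hfg u, hf0]
    simp [robinForm]

theorem mem_unboundedResolventSet {H : Type*} [NormedAddCommGroup H] [InnerProductSpace ℂ H]
    {A : H →ₗ.[ℂ] H} {z : ℂ} (R : H →L[ℂ] H) (h1 : ∀ p ∈ A.graph, R (p.2 - z • p.1) = p.1)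
    (h2 : ∀ y, (R y, y + z • R y) ∈ A.graph) : z ∈ unboundedResolventSet A := by
  refine ⟨R, fun x => h1 _ (A.mem_graph x), fun y => ?_⟩
  obtain ⟨x, hx1, hx2⟩ := A.mem_graph_iff.mp (h2 y)
  exact ⟨x, hx1, by rw [hx1, hx2]; simp⟩

theorem inner_adjoint_toL2CLM {Ω : Set (Euc d)} (g : H1 Ω) (y : L2 Ω) :
    inner ℂ g ((toL2CLM Ω).adjoint y) = inner ℂ (toL2 g) y := by
  rw [ContinuousLinearMap.adjoint_inner_right, toL2CLM_apply]

theorem exists_inverse_formOp {Ω : Set (Euc d)} {β t c : ℝ} (hc : 0 < c)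
    (h : ∀ u : H1 Ω, c * ‖u‖ ^ 2 ≤ robinQuad Ω β u - t * ‖toL2 u‖ ^ 2) :
    ∃ B : H1 Ω →L[ℂ] H1 Ω, (∀ u, B (formOp Ω β t u) = u) ∧ ∀ u, formOp Ω β t (B u) = u := by
  have hunit : IsUnit (formOp Ω β t) := by
    refine ContinuousLinearMap.isUnit_of_forall_le_norm_inner_map _ (c := ⟨c, hc.le⟩) hc fun u => ?_
    rw [norm_inner_symm, inner_formOp_self, Complex.norm_real, mul_comm]
    exact (h u).trans (le_abs_self _)
  obtain ⟨A, hA⟩ := hunit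
  rw [← hA]
  exact ⟨↑A⁻¹, fun u => by rw [← mul_apply_eq_comp, A.inv_mul, one_apply_eq_self],
    fun u => by rw [← mul_apply_eq_comp, A.mul_inv, one_apply_eq_self]⟩

/-- The resolvent equation in `L²(Ω)` becomes an equation for the bounded operator `formOp` on
`H¹(Ω)`, to which Lax–Milgram applies. -/
theorem adjoint_eq_formOp_iff {Ω : Set (Euc d)} {β t : ℝ} {f : H1 Ω} {y : L2 Ω} :
    (toL2CLM Ω).adjoint y = formOp Ω β t f ↔
      ∀ g : H1 Ω, robinForm Ω β f g = inner ℂ (toL2 g) (y + (t : ℂ) • toL2 f) := by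
  have key : ∀ g : H1 Ω, inner ℂ g ((toL2CLM Ω).adjoint y) = inner ℂ g (formOp Ω β t f) ↔
      robinForm Ω β f g = inner ℂ (toL2 g) (y + (t : ℂ) • toL2 f) := fun g => by
    rw [inner_adjoint_toL2CLM, inner_formOp, inner_add_right, inner_smul_right,
      eq_sub_iff_add_eq, eq_comm]
  exact ⟨fun h g => (key g).mp (by rw [h]), fun h => ext_inner_left ℂ fun g => (key g).mpr (h g)⟩

/-- With `J` the embedding of `H¹` into `L²` and `B` the inverse of `formOp`, the resolvent is `J B
J*`. -/
theorem mem_resolventSet_of_coercive {Ω : Set (Euc d)} (hΩ : IsOpen Ω) {β t c : ℝ} (hc : 0 < c)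
    (h : ∀ u : H1 Ω, c * ‖u‖ ^ 2 ≤ robinQuad Ω β u - t * ‖toL2 u‖ ^ 2) :
    (t : ℂ) ∈ unboundedResolventSet (robinLaplacian Ω β) := by
  obtain ⟨B, hB1, hB2⟩ := exists_inverse_formOp hc h
  refine mem_unboundedResolventSet (toL2CLM Ω ∘L B ∘L (toL2CLM Ω).adjoint) (fun p hp => ?_)
    fun y => (mem_robinLaplacian_graph hΩ).mpr
      ⟨B ((toL2CLM Ω).adjoint y), rfl, adjoint_eq_formOp_iff.mp (hB2 _).symm⟩
  obtain ⟨f, hf, hfg⟩ := (mem_robinLaplacian_graph hΩ).mp hp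
  have h1 : (toL2CLM Ω).adjoint (p.2 - (t : ℂ) • p.1) = formOp Ω β t f :=
    adjoint_eq_formOp_iff.mpr fun g => by rw [hfg g, hf, sub_add_cancel]
  rw [ContinuousLinearMap.comp_apply, ContinuousLinearMap.comp_apply, h1, hB1, toL2CLM_apply, hf]

/-- An `L²` gap upgrades to `H¹` coercivity: the trace bound gives a Gårding inequality that retains
half of the gradient term, and a multiple of the `L²` gap absorbs the negative remainder. -/
theorem coercive_of_le {Ω : Set (Euc d)} (hT : HasTraceBound Ω) {β : ℝ} (hβ : 0 ≤ β) {t δ : ℝ}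
    (hδ : 0 < δ) (h : ∀ u : H1 Ω, δ * ‖toL2 u‖ ^ 2 ≤ robinQuad Ω β u - t * ‖toL2 u‖ ^ 2) :
    ∃ c : ℝ, 0 < c ∧ ∀ u : H1 Ω, c * ‖u‖ ^ 2 ≤ robinQuad Ω β u - t * ‖toL2 u‖ ^ 2 := by
  obtain ⟨C, hC, H⟩ := hT (1 / (2 * (β + 1))) (by positivity)
  -- Adding `K` times the gap cancels the loss `β * C + |t|` and leaves `1 / 2` in front of both
  -- squared norms.
  set K : ℝ := (β * C + |t| + 1 / 2) / δ with hK
  have hK0 : 0 ≤ K := by positivity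
  refine ⟨(1 / 2) / (1 + K), by positivity, fun u => ?_⟩
  have h1 := mul_le_mul_of_nonneg_left (H u) hβ
  have h2 := h u
  have h3 : β * (1 / (2 * (β + 1))) ≤ 1 / 2 := by
    rw [mul_one_div, div_le_div_iff₀ (by positivity) (by positivity)]
    linarith
  have h4 := mul_le_mul_of_nonneg_right h3 (sq_nonneg ‖grad u‖)
  have h5 := mul_le_mul_of_nonneg_right (le_abs_self t) (sq_nonneg ‖toL2 u‖)
  have h6 : (1 / 2) * ‖grad u‖ ^ 2 - (β * C + |t|) * ‖toL2 u‖ ^ 2 ≤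
      robinQuad Ω β u - t * ‖toL2 u‖ ^ 2 := by
    rw [robinQuad]
    linarith
  have h7 := mul_le_mul_of_nonneg_left h2 hK0
  have h8 : K * (δ * ‖toL2 u‖ ^ 2) = (β * C + |t| + 1 / 2) * ‖toL2 u‖ ^ 2 := by
    rw [hK]; field_simp
  rw [div_mul_eq_mul_div, div_le_iff₀ (by positivity), norm_sq_eq]
  linarith

/-- Let `a` be the nonnegative form of the operator minus `l`. If a bounded inverse `R` existed, put
`f = R u` and `ρ = ‖R‖ + 1`. Then `a(u, f) = ‖u‖²` and `a(f, f) ≤ ρ ‖u‖²`, so `a ≥ 0` at `u - ρ⁻¹ f`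
yields `a(u, u) ≥ ρ⁻¹ ‖u‖²` in `L²` norms for every `u`, contradicting the choice of a
near-minimizer. -/
theorem mem_spectrum_of_isInf {Ω : Set (Euc d)} (hΩ : IsOpen Ω) {β l : ℝ}
    (h1 : ∀ u : H1 Ω, l * ‖toL2 u‖ ^ 2 ≤ robinQuad Ω β u)
    (h2 : ∀ δ : ℝ, 0 < δ → ∃ u : H1 Ω, robinQuad Ω β u < (l + δ) * ‖toL2 u‖ ^ 2) :
    (l : ℂ) ∈ unboundedSpectrum (robinLaplacian Ω β) := by
  rintro ⟨R, -, hR⟩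
  obtain ⟨u, hu⟩ := h2 (‖R‖ + 1)⁻¹ (by positivity)
  obtain ⟨x, hx, hxu⟩ := hR (toL2 u)
  obtain ⟨f, hf, hfg⟩ := (mem_robinLaplacian_graph hΩ).mp ((robinLaplacian Ω β).mem_graph x)
  have hA : ∀ g, inner ℂ g (formOp Ω β l f) = inner ℂ (toL2 g) (toL2 u) := fun g => by
    have hf' : toL2 f = (x : L2 Ω) := hf
    rw [inner_formOp, hfg g, hf', ← inner_smul_right, ← inner_sub_right, hxu]
  have hpos : ∀ w : H1 Ω, 0 ≤ (inner ℂ w (formOp Ω β l w)).re := fun w => by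
    rw [inner_formOp_self, Complex.ofReal_re]
    linarith [h1 w]
  have hsymm : inner ℂ f (formOp Ω β l u) =
      starRingEnd ℂ (inner ℂ u (formOp Ω β l f)) := by
    rw [inner_formOp, inner_formOp, robinForm, robinForm]
    simp only [map_sub, map_mul, inner_conj_symm, Complex.conj_ofReal]
  have hn : inner ℂ u (formOp Ω β l f) = ((‖toL2 u‖ ^ 2 : ℝ) : ℂ) := by
    rw [hA, inner_self_eq_norm_sq_to_K]
    push_cast
    rfl
  have hff : (inner ℂ f (formOp Ω β l f)).re ≤ (‖R‖ + 1) * ‖toL2 u‖ ^ 2 := by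
    rw [hA]
    refine (Complex.re_le_norm _).trans ((norm_inner_le_norm _ _).trans ?_)
    have hf' : toL2 f = R (toL2 u) := hf.trans hx
    rw [hf']
    nlinarith [R.le_opNorm (toL2 u), norm_nonneg (toL2 u), norm_nonneg (R (toL2 u))]
  set ρ := ‖R‖ + 1 with hρ
  have hρ0 : 0 < ρ := by positivity
  set c : ℂ := ((ρ⁻¹ : ℝ) : ℂ) with hc
  have hl : ∀ w : H1 Ω, inner ℂ (c • f) w = c * inner ℂ f w := fun w => by
    have : inner ℂ (c • f) w = starRingEnd ℂ c * inner ℂ f w := inner_smul_left f w c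
    rwa [hc, Complex.conj_ofReal] at this
  have hr : ∀ w v : H1 Ω, inner ℂ w (c • v) = c * inner ℂ w v := fun w v => inner_smul_right w v c
  have key := hpos (u - c • f)
  rw [map_sub, map_smul, inner_sub_left, inner_sub_right, inner_sub_right, hr, hr, hl, hl, hsymm,
    hn, inner_formOp_self, Complex.conj_ofReal, hc] at key
  simp only [Complex.sub_re, Complex.re_ofReal_mul, Complex.ofReal_re] at key
  have h3 : ρ⁻¹ * (ρ⁻¹ * (inner ℂ f (formOp Ω β l f)).re) ≤ ρ⁻¹ * ‖toL2 u‖ ^ 2 := by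
    refine mul_le_mul_of_nonneg_left ?_ (by positivity)
    rw [inv_mul_le_iff₀ hρ0]
    exact hff
  linarith

/-- The Rayleigh infimum is the least real point of the spectrum, so `sInf` is a true minimum and
not a default value. -/
theorem robinBottom_eq {Ω : Set (Euc d)} (hΩ : IsOpen Ω) (hT : HasTraceBound Ω) {β : ℝ}
    (hβ : 0 ≤ β) {l : ℝ} (h1 : ∀ u : H1 Ω, l * ‖toL2 u‖ ^ 2 ≤ robinQuad Ω β u)
    (h2 : ∀ δ : ℝ, 0 < δ → ∃ u : H1 Ω, robinQuad Ω β u < (l + δ) * ‖toL2 u‖ ^ 2) :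
    robinBottom Ω β = l := by
  refine IsLeast.csInf_eq ⟨mem_spectrum_of_isInf hΩ h1 h2, fun t ht => ?_⟩
  by_contra! hlt
  obtain ⟨c, hc, H⟩ := coercive_of_le hT hβ (t := t) (sub_pos.mpr hlt) fun u => by
    linarith [h1 u]
  exact ht (mem_resolventSet_of_coercive hΩ hc H)

theorem exists_rayleigh_inf {Ω : Set (Euc d)} (hT : HasTraceBound Ω) (hne : ∃ u : H1 Ω, toL2 u ≠ 0)
    {β : ℝ} (hβ : 0 ≤ β) : ∃ l : ℝ, (∀ u : H1 Ω, l * ‖toL2 u‖ ^ 2 ≤ robinQuad Ω β u) ∧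
      ∀ δ : ℝ, 0 < δ → ∃ u : H1 Ω, robinQuad Ω β u < (l + δ) * ‖toL2 u‖ ^ 2 := by
  obtain ⟨C, hC, H⟩ := hT (1 / (β + 1)) (by positivity)
  have hlow : ∀ u : H1 Ω, -(β * C) * ‖toL2 u‖ ^ 2 ≤ robinQuad Ω β u := fun u => by
    have h1 := mul_le_mul_of_nonneg_left (H u) hβ
    have h3 : β * (1 / (β + 1)) ≤ 1 := by
      rw [mul_one_div, div_le_one (by positivity)]
      linarith
    have h4 := mul_le_mul_of_nonneg_right h3 (sq_nonneg ‖grad u‖)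
    rw [robinQuad]
    linarith
  set S : Set ℝ := {r | ∃ u : H1 Ω, toL2 u ≠ 0 ∧ r = robinQuad Ω β u / ‖toL2 u‖ ^ 2} with hS
  have hSne : S.Nonempty := by
    obtain ⟨u, hu⟩ := hne
    exact ⟨_, u, hu, rfl⟩
  have hSb : BddBelow S := by
    refine ⟨-(β * C), ?_⟩
    rintro r ⟨u, hu, rfl⟩
    rw [le_div_iff₀ (by have := norm_pos_iff.mpr hu; positivity)]
    exact hlow u
  refine ⟨sInf S, fun u => ?_, fun δ hδ => ?_⟩
  · by_cases hu : toL2 u = 0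
    · have := hlow u
      rw [hu] at this ⊢
      simpa using this
    · rw [← le_div_iff₀ (by have := norm_pos_iff.mpr hu; positivity)]
      exact csInf_le hSb ⟨u, hu, rfl⟩
  · obtain ⟨r, ⟨u, hu, rfl⟩, hr⟩ := exists_lt_of_csInf_lt hSne (lt_add_of_pos_right (sInf S) hδ)
    refine ⟨u, ?_⟩
    rwa [div_lt_iff₀ (by have := norm_pos_iff.mpr hu; positivity)] at hr

/-- The Rayleigh quotient is normalized in `L²`, the trace norm in `H¹`. The former is passed to the
latter by `‖toL2 u‖ ≤ ‖u‖` in one direction and by `coercive_of_le` in the other. -/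
theorem isRobinRoot_iff {Ω : Set (Euc d)} (hΩ : IsOpen Ω) (hT : HasTraceBound Ω)
    (hpos : 0 < ‖trace Ω‖) {β : ℝ} : IsRobinRoot Ω β ↔ β = (‖trace Ω‖ ^ 2)⁻¹ := by
  have hpos2 : 0 < ‖trace Ω‖ ^ 2 := by positivity
  have hquad : ∀ (β : ℝ) (u : H1 Ω),
      robinQuad Ω β u = ‖u‖ ^ 2 - ‖toL2 u‖ ^ 2 - β * ‖trace Ω u‖ ^ 2 := fun β u => by
    rw [robinQuad, norm_sq_eq]; ring
  have hop : ∀ u : H1 Ω, ‖trace Ω u‖ ^ 2 ≤ ‖trace Ω‖ ^ 2 * ‖u‖ ^ 2 := fun u => by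
    rw [← mul_pow]
    exact pow_le_pow_left₀ (norm_nonneg _) ((trace Ω).le_opNorm u) 2
  have hopt : ∀ K : ℝ, 0 ≤ K → (∀ u : H1 Ω, ‖trace Ω u‖ ^ 2 ≤ K * ‖u‖ ^ 2) →
      ‖trace Ω‖ ^ 2 ≤ K := fun K hK h => by
    have : ‖trace Ω‖ ≤ Real.sqrt K := by
      refine (trace Ω).opNorm_le_bound (Real.sqrt_nonneg _) fun u => ?_
      refine (abs_le_of_sq_le_sq' ?_ (by positivity)).2
      rw [mul_pow, Real.sq_sqrt hK]
      exact h u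
    exact (Real.le_sqrt (ContinuousLinearMap.opNorm_nonneg _) hK).mp this
  constructor
  · rintro ⟨hβ, hb⟩
    have hne : ∃ u : H1 Ω, toL2 u ≠ 0 := by
      by_contra! h
      refine hpos.not_ge ((trace Ω).opNorm_le_bound le_rfl fun u => ?_)
      rw [toL2_injective hΩ ((h u).trans (map_zero toL2).symm), map_zero, norm_zero, zero_mul]
    obtain ⟨l, hl1, hl2⟩ := exists_rayleigh_inf hT hne hβ.le
    obtain rfl : l = -1 := (robinBottom_eq hΩ hT hβ.le hl1 hl2).symm.trans hb
    have hle : ‖trace Ω‖ ^ 2 ≤ β⁻¹ := hopt _ (by positivity) fun u => by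
      have := hl1 u
      rw [hquad] at this
      rw [le_inv_mul_iff₀ hβ]
      linarith
    have hge : β⁻¹ ≤ ‖trace Ω‖ ^ 2 := by
      by_contra! hlt
      have h1 : β * ‖trace Ω‖ ^ 2 < 1 := by
        have := mul_lt_mul_of_pos_left hlt hβ
        rwa [mul_inv_cancel₀ hβ.ne'] at this
      -- If `β ‖trace Ω‖² < 1`, the form plus `‖toL2 u‖²` is at least `(1 - β ‖trace Ω‖²) ‖u‖²`, so
      -- this difference is a gap above `-1` that no near-minimizer can enter.
      obtain ⟨u, hu⟩ := hl2 (1 - β * ‖trace Ω‖ ^ 2) (by linarith)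
      rw [hquad] at hu
      have h2 := mul_le_mul_of_nonneg_left (hop u) hβ.le
      have h3 : ‖toL2 u‖ ^ 2 ≤ ‖u‖ ^ 2 := by
        rw [norm_sq_eq]; linarith [sq_nonneg ‖grad u‖]
      have h4 := mul_le_mul_of_nonneg_left h3 (sub_nonneg.mpr h1.le)
      linarith
    rw [le_antisymm hle hge, inv_inv]
  · rintro rfl
    have hβ : 0 < (‖trace Ω‖ ^ 2)⁻¹ := by positivity
    refine ⟨hβ, robinBottom_eq hΩ hT hβ.le (fun u => ?_) fun δ hδ => ?_⟩
    · rw [hquad]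
      have := mul_le_mul_of_nonneg_left (hop u) hβ.le
      rw [inv_mul_cancel_left₀ hpos2.ne'] at this
      linarith
    · by_contra! h
      -- A gap above `-1` would give coercivity with constant `c`, improving the optimal trace
      -- constant by the factor `1 - c`. For `c > 1` the factor is negative and the trace would
      -- vanish.
      obtain ⟨c, hc, H⟩ := coercive_of_le hT hβ.le (t := -1) hδ fun u => by linarith [h u]
      have hb : ∀ u : H1 Ω, ‖trace Ω u‖ ^ 2 ≤ (‖trace Ω‖ ^ 2 * (1 - c)) * ‖u‖ ^ 2 := fun u => by
        have h1 := H u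
        rw [hquad] at h1
        have h2 : (‖trace Ω‖ ^ 2)⁻¹ * ‖trace Ω u‖ ^ 2 ≤ (1 - c) * ‖u‖ ^ 2 := by linarith
        rwa [inv_mul_le_iff₀ hpos2, ← mul_assoc] at h2
      by_cases hc1 : c ≤ 1
      · have := hopt _ (mul_nonneg hpos2.le (sub_nonneg.mpr hc1)) hb
        nlinarith
      · have : ‖trace Ω‖ ^ 2 ≤ 0 := hopt 0 le_rfl fun u => by
          refine (hb u).trans ?_
          refine mul_le_mul_of_nonneg_right ?_ (sq_nonneg _)
          exact mul_nonpos_of_nonneg_of_nonpos hpos2.le (by linarith)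
        linarith

/-! ### Robin roots of Lipschitz domains and the lower bound for extension operators. -/

theorem IsLipschitzDomain.isRobinRoot_iff {Ω : Set (Euc d)} (hΩ : IsLipschitzDomain Ω)
    (hne : Ω ≠ Set.univ) {β : ℝ} : IsRobinRoot Ω β ↔ β = (‖trace Ω‖ ^ 2)⁻¹ :=
  RobinExtension.isRobinRoot_iff hΩ.isOpen hΩ.hasTraceBound (hΩ.norm_trace_pos hne)

theorem IsLipschitzDomain.existsUnique_isRobinRoot {Ω : Set (Euc d)} (hΩ : IsLipschitzDomain Ω)
    (hne : Ω ≠ Set.univ) : ∃! β : ℝ, IsRobinRoot Ω β :=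
  ⟨_, (hΩ.isRobinRoot_iff hne).mpr rfl, fun _ h => (hΩ.isRobinRoot_iff hne).mp h⟩

/-- The exterior part of `E f` carries the boundary values of `f`, and the exterior trace norm
limits how cheaply these can be attained. -/
theorem IsLipschitzDomain.norm_sq_add_le {Ω : Set (Euc d)} (hΩ : IsLipschitzDomain Ω)
    (hne : Ω ≠ Set.univ) {E : H1 Ω →L[ℂ] H1 (Set.univ : Set (Euc d))}
    (hE : IsExtensionOperator E) (f : H1 Ω) :
    ‖f‖ ^ 2 + ‖trace Ω f‖ ^ 2 / ‖trace (closure Ω)ᶜ‖ ^ 2 ≤ ‖E‖ ^ 2 * ‖f‖ ^ 2 := by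
  have hΩ' := hΩ.compl_closure hne
  have hTe := hΩ'.norm_trace_pos hΩ.compl_closure_ne_univ
  have hdisj : Disjoint Ω (closure Ω)ᶜ :=
    Set.disjoint_compl_right_iff_subset.mpr subset_closure
  have h1 := norm_restr_sq_add_le isClosed_closure.isOpen_compl.measurableSet hdisj (E f)
  rw [restr_extension hΩ.isOpen hE] at h1
  have h2 := hΩ.norm_trace_restr hne (E f)
  rw [restr_extension hΩ.isOpen hE] at h2
  have h3 := (trace (closure Ω)ᶜ).le_opNorm (restr (closure Ω)ᶜ (E f))
  rw [h2] at h3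
  have h4 := pow_le_pow_left₀ (norm_nonneg _) h3 2
  rw [mul_pow] at h4
  have h5 : ‖trace Ω f‖ ^ 2 / ‖trace (closure Ω)ᶜ‖ ^ 2 ≤ ‖restr (closure Ω)ᶜ (E f)‖ ^ 2 := by
    rw [div_le_iff₀ (by positivity), mul_comm]
    exact h4
  have h6 := pow_le_pow_left₀ (norm_nonneg _) (E.le_opNorm f) 2
  rw [mul_pow] at h6
  linarith

theorem IsLipschitzDomain.one_add_le_norm_sq {Ω : Set (Euc d)} (hΩ : IsLipschitzDomain Ω)
    (hne : Ω ≠ Set.univ) {E : H1 Ω →L[ℂ] H1 (Set.univ : Set (Euc d))}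
    (hE : IsExtensionOperator E) :
    1 + ‖trace Ω‖ ^ 2 / ‖trace (closure Ω)ᶜ‖ ^ 2 ≤ ‖E‖ ^ 2 := by
  have hTe := (hΩ.compl_closure hne).norm_trace_pos hΩ.compl_closure_ne_univ
  have hTi := hΩ.norm_trace_pos hne
  have key := hΩ.norm_sq_add_le hne hE
  set K : ℝ := (‖E‖ ^ 2 - 1) * ‖trace (closure Ω)ᶜ‖ ^ 2 with hK
  have hb : ∀ f : H1 Ω, ‖trace Ω f‖ ^ 2 ≤ K * ‖f‖ ^ 2 := fun f => by
    have : ‖trace Ω f‖ ^ 2 / ‖trace (closure Ω)ᶜ‖ ^ 2 ≤ (‖E‖ ^ 2 - 1) * ‖f‖ ^ 2 := by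
      linarith [key f]
    rw [div_le_iff₀ (by positivity)] at this
    calc _ ≤ _ := this
      _ = _ := by rw [hK]; ring
  -- The sign of `K` is not yet known, so the square root is taken of `max K 0`; positivity of the
  -- trace norm then excludes the value `0`.
  have hsq : ‖trace Ω‖ ^ 2 ≤ max K 0 := by
    have h1 : ‖trace Ω‖ ≤ Real.sqrt (max K 0) := by
      refine (trace Ω).opNorm_le_bound (Real.sqrt_nonneg _) fun u => ?_
      refine (abs_le_of_sq_le_sq' ?_ (by positivity)).2
      rw [mul_pow, Real.sq_sqrt (le_max_right _ _)]
      exact (hb u).trans (mul_le_mul_of_nonneg_right (le_max_left _ _) (sq_nonneg _))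
    exact (Real.le_sqrt (ContinuousLinearMap.opNorm_nonneg _) (le_max_right _ _)).mp h1
  have hpos : 0 < ‖trace Ω‖ ^ 2 := by positivity
  have hle : ‖trace Ω‖ ^ 2 ≤ K := by
    rcases le_max_iff.mp hsq with h | h
    · exact h
    · exact absurd h hpos.not_ge
  have : ‖trace Ω‖ ^ 2 / ‖trace (closure Ω)ᶜ‖ ^ 2 ≤ ‖E‖ ^ 2 - 1 := by
    rw [div_le_iff₀ (by positivity)]
    exact hle
  linarith

theorem IsLipschitzDomain.sqrt_le_extNorm {Ω : Set (Euc d)} (hΩ : IsLipschitzDomain Ω)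
    (hne : Ω ≠ Set.univ) :
    ENNReal.ofReal (Real.sqrt (1 + ‖trace Ω‖ ^ 2 / ‖trace (closure Ω)ᶜ‖ ^ 2)) ≤ extNorm Ω := by
  refine le_iInf₂ fun E hE => ?_
  have h : Real.sqrt (1 + ‖trace Ω‖ ^ 2 / ‖trace (closure Ω)ᶜ‖ ^ 2) ≤ ‖E‖ :=
    Real.sqrt_le_iff.mpr ⟨ContinuousLinearMap.opNorm_nonneg _, hΩ.one_add_le_norm_sq hne hE⟩
  exact (ENNReal.ofReal_le_ofReal h).trans_eq (ofReal_norm E)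

end RobinExtension

end

theorem mainTheorem1 {d : ℕ} (hd : 2 ≤ d) (Ω : Set (EuclideanSpace ℝ (Fin d)))
    (hΩ : RobinExtension.IsLipschitzDomain Ω) (hΩ' : Ω ≠ Set.univ) :
    (∃! β : ℝ, RobinExtension.IsRobinRoot Ω β) ∧
    (∃! β : ℝ, RobinExtension.IsRobinRoot (closure Ω)ᶜ β) ∧
    (∀ βi βe : ℝ, RobinExtension.IsRobinRoot Ω βi →
      RobinExtension.IsRobinRoot (closure Ω)ᶜ βe →
      ENNReal.ofReal (Real.sqrt (1 + βe / βi)) ≤ RobinExtension.extNorm Ω) ∧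
    ENNReal.ofReal (Real.sqrt 2) ≤
      max (RobinExtension.extNorm Ω) (RobinExtension.extNorm (closure Ω)ᶜ) := by
  have hext := hΩ.compl_closure hΩ'
  have hne := hΩ.compl_closure_ne_univ
  have hi := hΩ.norm_trace_pos hΩ'
  have he := hext.norm_trace_pos hne
  refine ⟨hΩ.existsUnique_isRobinRoot hΩ', hext.existsUnique_isRobinRoot hne,
    fun βi βe h1 h2 => ?_, ?_⟩
  · rw [(hΩ.isRobinRoot_iff hΩ').mp h1, (hext.isRobinRoot_iff hne).mp h2, inv_div_inv]
    exact hΩ.sqrt_le_extNorm hΩ'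
  · have h1 := hΩ.sqrt_le_extNorm hΩ'
    have h2 := hext.sqrt_le_extNorm hne
    -- The exterior of the exterior is `Ω`, so the second bound contains the reciprocal quotient.
    rw [hΩ.compl_closure_compl_closure] at h2
    rcases le_total (‖RobinExtension.trace (closure Ω)ᶜ‖ ^ 2) (‖RobinExtension.trace Ω‖ ^ 2)
      with h | h
    · refine le_max_of_le_left (le_trans ?_ h1)
      refine ENNReal.ofReal_le_ofReal (Real.sqrt_le_sqrt ?_)
      have := (one_le_div (by positivity)).mpr h
      linarith
    · refine le_max_of_le_right (le_trans ?_ h2)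
      refine ENNReal.ofReal_le_ofReal (Real.sqrt_le_sqrt ?_)
      have := (one_le_div (by positivity)).mpr h
      linarith
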